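/- Let $n\ge 1$ and let $M$ be a compact smooth $n$-manifold without boundary. Write $|\Lambda^nM|^{\alpha}$ for the real powers of the density bundle of $M$. For a smooth Riemannian metric $g$ on $M$ let $R(g)$, $\mathrm{Ric}(g)$ and $|\mathrm{dVol}_g|$ be its scalar curvature, Ricci tensor and volume density, and put $$Q(g)=\frac{\int_M R(g)\,|\mathrm{dVol}_g|}{\mathrm{Vol}(g)^{1-2/n}}.$$ A smooth conformal class on $M$ is identified with a smooth positive definite section $c$ of $\mathrm{Sym}^2(T^*M)\otimes|\Lambda^nM|^{-2/n}$ with $\det c=1$ (the determinant of a section of this bundle is a function on $M$); the metrics in the class $c$ are the $\Omega^{2/n}c$, for $\Omega$ a smooth positive density. Let $I(c)=\inf_{g\in c}Q(g)$ be the Yamabe constant (the infimum may be taken in the extended reals); a metric $g\in c$ is a Yamabe metric for $c$ if it attains this infimum. Let $c_0$ be a smooth conformal class on $M$ and let $v$ be a smooth section of $\mathrm{Sym}^2(T^*M)\otimes|\Lambda^nM|^{-2/n}$ such that $\det(c_0+tv)$ vanishes nowhere on $M$ for any $t\in[0,1]$. For $t\in[0,1]$ put $$c_t=\frac{c_0+tv}{\det(c_0+tv)^{1/n}},$$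 which is again a smooth conformal class. Let $\Omega$ be a smooth positive density on $M$, with total volume $\mathrm{Vol}(\Omega)=\int_M\Omega$, such that $\Omega^{2/n}c_1$ is a Yamabe metric for $c_1$, and write $g_t=\Omega^{2/n}c_t$. Then the function of $t\in[0,1]$ given by the inner integral below is integrable, and $$\mathrm{Vol}(\Omega)^{1-2/n}\,\bigl[I(c_1)-I(c_0)\bigr]\ \ge\ \int_0^1\!\int_M\Bigl\langle v,\ \bigl(-\mathrm{Ric}(g_t)+\tfrac1n R(g_t)\,g_t\bigr)\det(c_0+tv)^{-1/n}\,\Omega^{1-2/n}\Bigr\rangle_{c_t}\,dt .$$ Here $\langle S,T\rangle_{c}=c^{ik}c^{jl}S_{ij}T_{kl}$, so that the integrand over $M$ is a density. -/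

import Mathlib

open scoped Manifold ContDiff

noncomputable section

namespace Yamabe

/-- Coordinate space. -/
abbrev Coord (n : ℕ) := EuclideanSpace ℝ (Fin n)

/-- The charts of the manifold `M`. -/
abbrev Chart (n : ℕ) (M : Type*) [TopologicalSpace M] [ChartedSpace (Coord n) M] :=
  atlas (Coord n) M

/-- The partial derivative `∂ᵢ f` at the point `y`. -/
def pderiv {n : ℕ} (i : Fin n) (f : Coord n → ℝ) (y : Coord n) : ℝ :=
  fderiv ℝ f y (EuclideanSpace.single i 1)

/-! ### Curvature of a metric in coordinates -/

section Curvature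

variable {n : ℕ}

/-- The Christoffel symbol
`Γᵏᵢⱼ = ½ ∑ₗ gᵏˡ (∂ᵢ gⱼₗ + ∂ⱼ gᵢₗ - ∂ₗ gᵢⱼ)` of the coordinate metric `g`. -/
def christoffel (g : Coord n → Matrix (Fin n) (Fin n) ℝ) (k i j : Fin n) (y : Coord n) : ℝ :=
  1 / 2 * ∑ l, (g y)⁻¹ k l *
    (pderiv i (fun z => g z j l) y + pderiv j (fun z => g z i l) y - pderiv l (fun z => g z i j) y)

/-- The Ricci tensor
`Ricᵢⱼ = ∑ₖ (∂ₖ Γᵏᵢⱼ - ∂ⱼ Γᵏᵢₖ) + ∑ₖₗ (Γᵏₖₗ Γˡᵢⱼ - Γᵏⱼₗ Γˡᵢₖ)` of the coordinate metric `g`. -/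
def ricci (g : Coord n → Matrix (Fin n) (Fin n) ℝ) (y : Coord n) : Matrix (Fin n) (Fin n) ℝ :=
  Matrix.of fun i j =>
    ∑ k, (pderiv k (christoffel g k i j) y - pderiv j (christoffel g k i k) y) +
    ∑ k, ∑ l, (christoffel g k k l y * christoffel g l i j y
      - christoffel g k j l y * christoffel g l i k y)

/-- The scalar curvature `R = ∑ᵢⱼ gⁱʲ Ricᵢⱼ` of the coordinate metric `g`. -/
def scalarCurv (g : Coord n → Matrix (Fin n) (Fin n) ℝ) (y : Coord n) : ℝ :=
  ∑ i, ∑ j, (g y)⁻¹ i j * ricci g y i j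

/-- The pairing `⟨S, T⟩_c = ∑ᵢⱼₖₗ cⁱᵏ cʲˡ Sᵢⱼ Tₖₗ` of two covariant 2-tensors. -/
def pairing (c S T : Matrix (Fin n) (Fin n) ℝ) : ℝ :=
  ∑ i, ∑ j, ∑ k, ∑ l, c⁻¹ i k * c⁻¹ j l * S i j * T k l

end Curvature

/-! ### Densities and weighted tensors -/

section Fields

variable (n : ℕ) (M : Type*) [TopologicalSpace M] [ChartedSpace (Coord n) M]

/-- The Jacobian matrix of the transition map `ψ ∘ φ⁻¹` at `y`. -/
def jacobian {n : ℕ} {M : Type*} [TopologicalSpace M] [ChartedSpace (Coord n) M]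
    (φ ψ : Chart n M) (y : Coord n) : Matrix (Fin n) (Fin n) ℝ :=
  Matrix.of fun i j => pderiv j (fun z => ψ.1 (φ.1.symm z) i) y

/-- A smooth positive density `Ω`, a section of `|Λⁿ M|`. In the chart `φ` it is
`coeff φ · |dy¹ ⋯ dyⁿ|`; the values of `coeff φ` outside the target of `φ` carry no meaning. -/
structure PosDensity where
  /-- The coefficient in each chart. -/
  coeff : Chart n M → Coord n → ℝ
  smooth : ∀ φ, ContDiffOn ℝ ∞ (coeff φ) φ.1.target
  pos : ∀ φ, ∀ y ∈ φ.1.target, 0 < coeff φ y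
  transform : ∀ φ ψ : Chart n M, ∀ x ∈ φ.1.source ∩ ψ.1.source,
    coeff φ (φ.1 x) = |(jacobian φ ψ (φ.1 x)).det| * coeff ψ (ψ.1 x)

/-- A smooth section of `Sym²(T*M) ⊗ |Λⁿ M|^α`. In the chart `φ` it is
`∑ᵢⱼ (coeff φ)ᵢⱼ dyⁱ dyʲ ⊗ |dy¹ ⋯ dyⁿ|^α`;
the values of `coeff φ` outside the target of `φ` carry no meaning. -/
structure WeightedTensor (α : ℝ) where
  /-- The coefficient matrix in each chart. -/
  coeff : Chart n M → Coord n → Matrix (Fin n) (Fin n) ℝ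
  symmetric : ∀ φ, ∀ y ∈ φ.1.target, (coeff φ y).IsSymm
  smooth : ∀ φ, ∀ i j, ContDiffOn ℝ ∞ (fun y => coeff φ y i j) φ.1.target
  transform : ∀ φ ψ : Chart n M, ∀ x ∈ φ.1.source ∩ ψ.1.source,
    coeff φ (φ.1 x) = |(jacobian φ ψ (φ.1 x)).det| ^ α •
      ((jacobian φ ψ (φ.1 x)).transpose * coeff ψ (ψ.1 x) * jacobian φ ψ (φ.1 x))

/-- A smooth Riemannian metric on `M`. -/
structure Metric extends WeightedTensor n M 0 where
  posDef : ∀ φ, ∀ y ∈ φ.1.target, (coeff φ y).PosDef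

/-- A smooth conformal class on `M`: a positive definite section of
`Sym²(T*M) ⊗ |Λⁿ M|^(-2/n)` with determinant `1`. -/
structure ConformalClass extends WeightedTensor n M (-2 / (n : ℝ)) where
  posDef : ∀ φ, ∀ y ∈ φ.1.target, (coeff φ y).PosDef
  det_eq_one : ∀ φ, ∀ y ∈ φ.1.target, (coeff φ y).det = 1

end Fields

section Constructions

variable {n : ℕ} {M : Type*} [TopologicalSpace M] [ChartedSpace (Coord n) M]

lemma ConformalClass.jacobian_det_ne_zero (c : ConformalClass n M) (φ ψ : Chart n M) {x : M}
    (hx : x ∈ φ.1.source ∩ ψ.1.source) : (jacobian φ ψ (φ.1 x)).det ≠ 0 := by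
  intro h
  have h1 := c.det_eq_one φ (φ.1 x) (φ.1.map_source hx.1)
  have hn : n ≠ 0 := by
    rintro rfl
    simp at h
  have : Nonempty (Fin n) := ⟨⟨0, Nat.pos_of_ne_zero hn⟩⟩
  rw [c.transform φ ψ x hx, Matrix.det_smul, Matrix.det_mul, h] at h1
  simp at h1

/-- The Riemannian metric `Ω^(2/n) c` in the conformal class `c`. -/
def PosDensity.metric (Ω : PosDensity n M) (c : ConformalClass n M) : Metric n M where
  coeff φ y := Ω.coeff φ y ^ (2 / (n : ℝ)) • c.coeff φ y
  symmetric φ y hy := (c.symmetric φ y hy).smul _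
  smooth φ i j := by
    have h : ContDiffOn ℝ ∞ (fun y => Ω.coeff φ y ^ (2 / (n : ℝ))) φ.1.target :=
      (Ω.smooth φ).rpow_const_of_ne fun y hy => (Ω.pos φ y hy).ne'
    simpa using h.mul (c.smooth φ i j)
  transform φ ψ x hx := by
    have hJ := abs_pos.2 (c.jacobian_det_ne_zero φ ψ hx)
    have hΩ := Ω.pos ψ _ (ψ.1.map_source hx.2)
    rw [Ω.transform φ ψ x hx, c.transform φ ψ x hx, Real.mul_rpow hJ.le hΩ.le, smul_smul,
      mul_right_comm, ← Real.rpow_add hJ]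
    simp [neg_div]
  posDef φ y hy := (c.posDef φ y hy).smul (Real.rpow_pos_of_pos (Ω.pos φ y hy) _)

open scoped MatrixOrder Matrix.Norms.L2Operator in
lemma posDef_add_smul {A B : Matrix (Fin n) (Fin n) ℝ} (hA : A.PosDef) (hB : B.IsSymm)
    (h : ∀ t : unitInterval, (A + (t : ℝ) • B).det ≠ 0) (t : unitInterval) : (A + (t : ℝ) • B).PosDef := by
  obtain ⟨S, hS⟩ := CStarAlgebra.nonneg_iff_eq_star_mul_self.mp hA.posSemidef.nonneg
  have hSu : IsUnit S := by
    rw [Matrix.isUnit_iff_isUnit_det, isUnit_iff_ne_zero]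
    intro h0
    have := hA.det_pos
    rw [hS, Matrix.det_mul, h0, mul_zero] at this
    exact this.false
  have hSd : IsUnit S.det := (Matrix.isUnit_iff_isUnit_det S).1 hSu
  have hSd' : IsUnit (star S).det := (Matrix.isUnit_iff_isUnit_det _).1 hSu.star
  set C := A + (t : ℝ) • B with hC
  have hCh : C.IsHermitian := by
    rw [Matrix.IsHermitian, Matrix.conjTranspose_eq_transpose_of_trivial, hC,
      Matrix.transpose_add, Matrix.transpose_smul, hB.eq,
      ← Matrix.conjTranspose_eq_transpose_of_trivial, hA.isHermitian.eq]
  set W := (star S)⁻¹ * C * S⁻¹ with hW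
  have hCW : C = star S * W * S := by
    rw [hW, ← mul_assoc, ← mul_assoc, Matrix.mul_nonsing_inv _ hSd', one_mul, mul_assoc,
      Matrix.nonsing_inv_mul _ hSd, mul_one]
  have hWh : W.IsHermitian := by
    rw [Matrix.IsHermitian, hW, Matrix.conjTranspose_mul, Matrix.conjTranspose_mul, hCh.eq,
      Matrix.conjTranspose_nonsing_inv, Matrix.conjTranspose_nonsing_inv,
      Matrix.star_eq_conjTranspose, Matrix.conjTranspose_conjTranspose, mul_assoc]
  rw [hCW, Matrix.IsUnit.posDef_star_left_conjugate_iff hSu, hWh.posDef_iff_eigenvalues_pos]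
  intro i
  by_contra! hi
  set m := hWh.eigenvalues i with hm
  have hx := hWh.mulVec_eigenvectorBasis i
  have hx0 : (hWh.eigenvectorBasis i).ofLp ≠ 0 := fun h0 =>
    hWh.eigenvectorBasis.orthonormal.ne_zero i (by ext k; exact congrFun h0 k)
  have hm1 : 0 < 1 - m := by linarith
  set r := 1 / (1 - m) with hr
  have hr0 : 0 ≤ r := by positivity
  have hr1 : r ≤ 1 := by rw [hr, div_le_one hm1]; linarith
  refine h ⟨r * t, mul_nonneg hr0 t.2.1, mul_le_one₀ hr1 t.2.1 t.2.2⟩ ?_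
  have e : A + (r * (t : ℝ)) • B = star S * ((1 - r) • 1 + r • W) * S := by
    rw [mul_add, add_mul, Matrix.mul_smul, Matrix.mul_smul, Matrix.smul_mul, Matrix.smul_mul,
      mul_one, ← hS, ← hCW, hC]
    module
  have hz : ((1 - r) • (1 : Matrix (Fin n) (Fin n) ℝ) + r • W).det = 0 := by
    refine Matrix.exists_mulVec_eq_zero_iff.1 ⟨_, hx0, ?_⟩
    rw [Matrix.add_mulVec, Matrix.smul_mulVec, Matrix.smul_mulVec, Matrix.one_mulVec, hx, smul_smul,
      ← add_smul]
    have : 1 - r + r * m = 0 := by rw [hr]; field_simp; ring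
    rw [← hm, this, zero_smul]
  change (A + (r * (t : ℝ)) • B).det = 0
  rw [e, Matrix.det_mul, Matrix.det_mul, hz]
  simp

/-- The conformal class `c_t = (c₀ + t v) / det(c₀ + t v)^(1/n)` for `t ∈ [0, 1]`, where
`det(c₀ + t v)` does not vanish for `t ∈ [0, 1]`. -/
def ConformalClass.path [NeZero n] (c₀ : ConformalClass n M) (v : WeightedTensor n M (-2 / (n : ℝ)))
    (hv : ∀ t : unitInterval, ∀ φ, ∀ y ∈ φ.1.target, (c₀.coeff φ y + (t : ℝ) • v.coeff φ y).det ≠ 0)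
    (t : unitInterval) : ConformalClass n M where
  coeff φ y := (c₀.coeff φ y + (t : ℝ) • v.coeff φ y).det ^ (-1 / (n : ℝ)) •
    (c₀.coeff φ y + (t : ℝ) • v.coeff φ y)
  symmetric φ y hy := ((c₀.symmetric φ y hy).add ((v.symmetric φ y hy).smul _)).smul _
  smooth φ i j := by
    have h : ∀ i j, ContDiffOn ℝ ∞
        (fun y => (c₀.coeff φ y + (t : ℝ) • v.coeff φ y) i j) φ.1.target := fun i j => by
      simpa using (c₀.smooth φ i j).add (contDiffOn_const.mul (v.smooth φ i j))
    have hd : ContDiffOn ℝ ∞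
        (fun y => (c₀.coeff φ y + (t : ℝ) • v.coeff φ y).det) φ.1.target := by
      simp only [Matrix.det_apply']
      exact ContDiffOn.sum fun σ _ => contDiffOn_const.mul (contDiffOn_prod fun k _ => h _ _)
    exact (hd.rpow_const_of_ne (hv t φ)).mul (h i j)
  transform φ ψ x hx := by
    have hJ := abs_pos.2 (c₀.jacobian_det_ne_zero φ ψ hx)
    have h : c₀.coeff φ (φ.1 x) + (t : ℝ) • v.coeff φ (φ.1 x) =
        |(jacobian φ ψ (φ.1 x)).det| ^ (-2 / (n : ℝ)) • ((jacobian φ ψ (φ.1 x)).transpose *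
          (c₀.coeff ψ (ψ.1 x) + (t : ℝ) • v.coeff ψ (ψ.1 x)) * jacobian φ ψ (φ.1 x)) := by
      rw [c₀.transform φ ψ x hx, v.transform φ ψ x hx, smul_comm, ← smul_add]
      simp [Matrix.mul_add, Matrix.add_mul]
    have hd : (c₀.coeff φ (φ.1 x) + (t : ℝ) • v.coeff φ (φ.1 x)).det =
        (c₀.coeff ψ (ψ.1 x) + (t : ℝ) • v.coeff ψ (ψ.1 x)).det := by
      have hn : (n : ℝ) ≠ 0 := NeZero.ne _
      rw [h, Matrix.det_smul, Matrix.det_mul, Matrix.det_mul, Matrix.det_transpose,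
        Fintype.card_fin, ← Real.rpow_mul_natCast hJ.le, div_mul_cancel₀ _ hn,
        Real.rpow_neg hJ.le, Real.rpow_two, sq_abs]
      have := c₀.jacobian_det_ne_zero φ ψ hx
      field_simp
    rw [hd, h, smul_comm, Matrix.mul_smul, Matrix.smul_mul]
  posDef φ y hy := by
    have h := posDef_add_smul (c₀.posDef φ y hy) (v.symmetric φ y hy)
      (fun s => hv s φ y hy) t
    exact h.smul (Real.rpow_pos_of_pos h.det_pos _)
  det_eq_one φ y hy := by
    have h := posDef_add_smul (c₀.posDef φ y hy) (v.symmetric φ y hy)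
      (fun s => hv s φ y hy) t
    have hn : (n : ℝ) ≠ 0 := NeZero.ne _
    rw [Matrix.det_smul, Fintype.card_fin, ← Real.rpow_mul_natCast h.det_pos.le,
      div_mul_cancel₀ _ hn, Real.rpow_neg_one, inv_mul_cancel₀ h.det_pos.ne']

/-- The metrics in the conformal class `c`: those of the form `Ω^(2/n) c`. -/
def ConformalClass.metrics (c : ConformalClass n M) : Set (Metric n M) :=
  {g | ∃ Ω : PosDensity n M, ∀ φ, ∀ y ∈ φ.1.target,
    g.coeff φ y = (Ω.metric c).coeff φ y}

end Constructions

/-! ### Integration and the Yamabe constant -/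

section Integration

variable {n : ℕ} {M : Type*} [TopologicalSpace M] [T2Space M] [CompactSpace M]
  [ChartedSpace (Coord n) M] [IsManifold (𝓡 n) ∞ M]

variable (n M) in
lemma exists_partition : ∃ ρ : SmoothPartitionOfUnity M (𝓡 n) M Set.univ,
    ρ.IsSubordinate fun x => (chartAt (Coord n) x).source :=
  SmoothPartitionOfUnity.exists_isSubordinate (𝓡 n) isClosed_univ _
    (fun x => (chartAt (Coord n) x).open_source)
    (fun x _ => Set.mem_iUnion.2 ⟨x, mem_chart_source _ x⟩)

variable (n M) in
/-- A smooth partition of unity on `M` subordinate to the cover by chart domains. -/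
def partition : SmoothPartitionOfUnity M (𝓡 n) M Set.univ := (exists_partition n M).choose

/-- The integral over `M` of the density given in each chart `φ` by `f φ · |dy¹ ⋯ dyⁿ|`,
computed with a partition of unity (it does not depend on the partition of unity, by the change
of variables formula). On the compact manifold `M`, only finitely many summands are nonzero. -/
def integralDensity (f : Chart n M → Coord n → ℝ) : ℝ :=
  ∑ᶠ x : M, ∫ y in (chartAt (Coord n) x).target,
    partition n M x ((chartAt (Coord n) x).symm y) * f ⟨_, chart_mem_atlas (Coord n) x⟩ y

/-- The total volume of a density. -/
def PosDensity.vol (Ω : PosDensity n M) : ℝ := integralDensity Ω.coeff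

/-- The volume of `M` for the metric `g`, the integral of `|dVol_g| = √(det g) |dy¹ ⋯ dyⁿ|`. -/
def Metric.vol (g : Metric n M) : ℝ :=
  integralDensity fun φ y => √(g.coeff φ y).det

/-- The total scalar curvature functional `Q(g) = (∫_M R(g) |dVol_g|) / Vol(g)^(1 - 2/n)`. -/
def Metric.totalScalar (g : Metric n M) : ℝ :=
  integralDensity (fun φ y => scalarCurv (g.coeff φ) y * √(g.coeff φ y).det) /
    g.vol ^ (1 - 2 / (n : ℝ))

/-- The Yamabe constant `I(c)`, the infimum of `Q` over the metrics in `c`, taken in the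
extended reals. -/
def ConformalClass.yamabeConstant (c : ConformalClass n M) : EReal :=
  ⨅ g ∈ c.metrics, (g.totalScalar : EReal)

/-- `g` is a Yamabe metric for `c`: it lies in `c` and minimizes `Q` there. -/
def IsYamabeMetric (c : ConformalClass n M) (g : Metric n M) : Prop :=
  g ∈ c.metrics ∧ ∀ g' ∈ c.metrics, g.totalScalar ≤ g'.totalScalar

/-- For `t ∈ [0, 1]`, with `c_t = (c₀ + t v) / det(c₀ + t v)^(1/n)` and `g_t = Ω^(2/n) c_t`, the
integral over `M` of the density
`⟨v, (-Ric(g_t) + (1/n) R(g_t) g_t) det(c₀ + t v)^(-1/n) Ω^(1 - 2/n)⟩_{c_t}`. -/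
def ConformalClass.pathIntegrand [NeZero n] (c₀ : ConformalClass n M)
    (v : WeightedTensor n M (-2 / (n : ℝ)))
    (hv : ∀ t : unitInterval, ∀ φ, ∀ y ∈ φ.1.target,
      (c₀.coeff φ y + (t : ℝ) • v.coeff φ y).det ≠ 0)
    (Ω : PosDensity n M) (t : unitInterval) : ℝ :=
  integralDensity fun φ y =>
    pairing ((c₀.path v hv t).coeff φ y) (v.coeff φ y)
      (((c₀.coeff φ y + (t : ℝ) • v.coeff φ y).det ^ (-1 / (n : ℝ)) *
          Ω.coeff φ y ^ (1 - 2 / (n : ℝ))) •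
        (-ricci ((Ω.metric (c₀.path v hv t)).coeff φ) y +
          (1 / (n : ℝ) * scalarCurv ((Ω.metric (c₀.path v hv t)).coeff φ) y) •
            (Ω.metric (c₀.path v hv t)).coeff φ y))

end Integration

end Yamabe

end

/-!
Write `g_t = Ω^(2/n) c_t`. Since `det c_t = 1`, the volume density of every `g_t` is `Ω`, so the
volume is constant along the path and `Vol(Ω)^(1-2/n) (Q(g₁) - Q(g₀))` is the difference at the
endpoints of `E(t) = ∫ R(g_t) Ω`. As `g₁` is a Yamabe metric, `I(c₁) = Q(g₁)`, while
`I(c₀) ≤ Q(g₀)` because `g₀` lies in the class `c₀`. So it suffices that `E(1) - E(0)` is the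
integral of `pathIntegrand`.

Locally this is the first variation of scalar curvature, with the volume density `Ω` held fixed
(`dirDeriv_scalarAlong`): the contracted Christoffel symbols `Γᵏᵢₖ = ∂ᵢ log Ω` do not vary, and
Palatini's formula reduces to `δ(R Ω) = -⟨δg, Ric⟩ Ω + ∂ₖ Xᵏ` with `Xᵏ = Ω gⁱʲ δΓᵏᵢⱼ`
(`variationField`). By Jacobi's formula `δg` is `v` up to normalization and a multiple of `g`, which
turns the first term into the integrand of `pathIntegrand` (`pairing_variation`).

The field `X` is a vector density, since the inhomogeneous term in the transformation law of the
Christoffel symbols does not depend on `t` (`christoffel_transform`, `variationField_transform`).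
Hence `∫ ∂ₖ Xᵏ = 0` (`integralDensity_divergence`). The divergence theorem is proved with a
partition of unity `ρ`: integrating by parts in each chart gives `-∑ₓ ∫ ⟨X, dρₓ⟩`, and
rewriting this in the charts of a second copy of the partition produces `d(∑ₓ ρₓ) = 0`. In this form
only the density `⟨X, dρₓ⟩` has to be moved between charts, and the invariance of the divergence is
not needed.

Finally `E(1) - E(0) = ∫₀¹ E'` is the fundamental theorem of calculus at each point of a chart,
combined with Fubini's theorem (`integral_integralDensity_dirDeriv`). The curvature of `g_t` is
treated as a function on an open subset of `ℝ × ℝⁿ`, where the derivatives in `t` and in space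
commute; the Christoffel symbols and the Ricci tensor are therefore defined for derivatives along
arbitrary directions in a normed space (`christoffelAlong`, `ricciAlong`).
-/

noncomputable section

namespace Yamabe

/-! ### Directional derivatives -/

section Calculus

variable {V : Type*} [NormedAddCommGroup V] [NormedSpace ℝ V] {n : ℕ}

/-- The derivative of `f` at `p` in the direction `v`. -/
def dirDeriv (v : V) (f : V → ℝ) (p : V) : ℝ := fderiv ℝ f p v

lemma dirDeriv_mul (v : V) {f g : V → ℝ} {p : V} (hf : DifferentiableAt ℝ f p)
    (hg : DifferentiableAt ℝ g p) :
    dirDeriv v (fun q => f q * g q) p = dirDeriv v f p * g p + f p * dirDeriv v g p := by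
  simp only [dirDeriv]
  rw [fderiv_fun_mul hf hg]
  simp; ring

lemma dirDeriv_add (v : V) {f g : V → ℝ} {p : V} (hf : DifferentiableAt ℝ f p)
    (hg : DifferentiableAt ℝ g p) :
    dirDeriv v (fun q => f q + g q) p = dirDeriv v f p + dirDeriv v g p := by
  simp only [dirDeriv]
  rw [fderiv_fun_add hf hg]
  simp

lemma dirDeriv_sub (v : V) {f g : V → ℝ} {p : V} (hf : DifferentiableAt ℝ f p)
    (hg : DifferentiableAt ℝ g p) :
    dirDeriv v (fun q => f q - g q) p = dirDeriv v f p - dirDeriv v g p := by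
  simp only [dirDeriv]
  rw [fderiv_fun_sub hf hg]
  simp

lemma dirDeriv_sum (v : V) {ι : Type*} {s : Finset ι} {f : ι → V → ℝ} {p : V}
    (hf : ∀ i ∈ s, DifferentiableAt ℝ (f i) p) :
    dirDeriv v (fun q => ∑ i ∈ s, f i q) p = ∑ i ∈ s, dirDeriv v (f i) p := by
  simp only [dirDeriv]
  rw [fderiv_fun_sum hf]
  simp

lemma dirDeriv_const (v : V) (a : ℝ) (p : V) : dirDeriv v (fun _ => a) p = 0 := by
  simp [dirDeriv]

lemma dirDeriv_congr (v : V) {f g : V → ℝ} {p : V} (h : f =ᶠ[nhds p] g) :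
    dirDeriv v f p = dirDeriv v g p := by
  simp only [dirDeriv]
  rw [h.fderiv_eq]

/-- Differentiability of a smooth function, under a short name since it is used at every application
of a differentiation rule. -/
lemma _root_.ContDiffAt.diff {f : V → ℝ} {p : V} (hf : ContDiffAt ℝ ∞ f p) :
    DifferentiableAt ℝ f p := hf.differentiableAt (by simp)

lemma contDiffAt_dirDeriv (v : V) {f : V → ℝ} {p : V} (hf : ContDiffAt ℝ ∞ f p) :
    ContDiffAt ℝ ∞ (dirDeriv v f) p := by
  have h : ContDiffAt ℝ ∞ (fderiv ℝ f) p := hf.fderiv_right (by simp)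
  exact h.clm_apply contDiffAt_const

lemma dirDeriv_comm (v w : V) {f : V → ℝ} {p : V} (hf : ContDiffAt ℝ ∞ f p) :
    dirDeriv v (dirDeriv w f) p = dirDeriv w (dirDeriv v f) p := by
  have h : DifferentiableAt ℝ (fderiv ℝ f) p :=
    (hf.fderiv_right (m := ∞) (by simp)).differentiableAt (by simp)
  have e : ∀ u u' : V, dirDeriv u (dirDeriv u' f) p = fderiv ℝ (fderiv ℝ f) p u u' := by
    intro u u'
    simp only [dirDeriv]
    unfold dirDeriv
    rw [fderiv_clm_apply h (by fun_prop)]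
    simp
  rw [e, e]
  exact (hf.isSymmSndFDerivAt (by simpa using WithTop.coe_le_coe.2 (le_top (a := (2 : ℕ∞))))).eq v w

/-! ### Derivatives of the determinant and of the inverse matrix -/

variable {G : V → Matrix (Fin n) (Fin n) ℝ} {p : V}

lemma contDiffAt_det (hG : ∀ i j, ContDiffAt ℝ ∞ (fun q => G q i j) p) :
    ContDiffAt ℝ ∞ (fun q => (G q).det) p := by
  simp only [Matrix.det_apply']
  exact ContDiffAt.sum fun σ _ => contDiffAt_const.mul (contDiffAt_prod fun k _ => hG _ _)

lemma contDiffAt_inv (hG : ∀ i j, ContDiffAt ℝ ∞ (fun q => G q i j) p) (hd : (G p).det ≠ 0)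
    (i j : Fin n) : ContDiffAt ℝ ∞ (fun q => (G q)⁻¹ i j) p := by
  simp only [Matrix.inv_def, Ring.inverse_eq_inv', Matrix.smul_apply, smul_eq_mul,
    Matrix.adjugate_apply]
  refine ((contDiffAt_det hG).inv hd).mul (contDiffAt_det fun a b => ?_)
  simp only [Matrix.updateRow_apply]
  split_ifs
  · exact contDiffAt_const
  · exact hG a b

/-- The derivative `∂ᵥ A⁻¹ = - A⁻¹ (∂ᵥ A) A⁻¹` of the inverse matrix, in components. -/
lemma dirDeriv_inv (v : V) (hG : ∀ i j, ContDiffAt ℝ ∞ (fun q => G q i j) p)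
    (hd : (G p).det ≠ 0) (i j : Fin n) :
    dirDeriv v (fun q => (G q)⁻¹ i j) p =
      -∑ a, ∑ b, (G p)⁻¹ i a * dirDeriv v (fun q => G q a b) p * (G p)⁻¹ b j := by
  set A : Matrix (Fin n) (Fin n) ℝ := Matrix.of fun i j => dirDeriv v (fun q => (G q)⁻¹ i j) p
  set B : Matrix (Fin n) (Fin n) ℝ := Matrix.of fun i j => dirDeriv v (fun q => G q i j) p
  have hu : IsUnit (G p).det := isUnit_iff_ne_zero.2 hd
  have hI := contDiffAt_inv hG hd
  have key : A * G p + (G p)⁻¹ * B = 0 := by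
    ext a b
    have h1 : (fun q => ∑ c, (G q)⁻¹ a c * G q c b) =ᶠ[nhds p]
        fun _ => (1 : Matrix (Fin n) (Fin n) ℝ) a b := by
      filter_upwards [(contDiffAt_det hG).continuousAt.eventually_ne hd] with q hq
      rw [← Matrix.nonsing_inv_mul (G q) (isUnit_iff_ne_zero.2 hq), Matrix.mul_apply]
    have h2 := dirDeriv_congr v h1
    rw [dirDeriv_const, dirDeriv_sum v (fun c _ => ContDiffAt.diff ((hI a c).mul (hG c b)))] at h2
    simp only [Matrix.add_apply, Matrix.mul_apply, Matrix.zero_apply, ← Finset.sum_add_distrib]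
    rw [← h2]
    refine Finset.sum_congr rfl fun c _ => ?_
    rw [dirDeriv_mul v (hI a c).diff (hG c b).diff]
    rfl
  have hA : A = -((G p)⁻¹ * B * (G p)⁻¹) := by
    have h3 : A * G p = -((G p)⁻¹ * B) := eq_neg_of_add_eq_zero_left key
    calc A = A * G p * (G p)⁻¹ := by rw [Matrix.mul_assoc, Matrix.mul_nonsing_inv _ hu, mul_one]
      _ = _ := by rw [h3, Matrix.neg_mul]
  have h4 := congrFun (congrFun hA i) j
  rw [Matrix.neg_apply, Matrix.mul_apply] at h4
  simp only [Matrix.mul_apply, Finset.sum_mul] at h4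
  rw [Finset.sum_comm] at h4
  exact h4

/-- Jacobi's formula `∂ᵥ det A = det A · tr (A⁻¹ ∂ᵥ A)`. -/
lemma dirDeriv_det (v : V) (hG : ∀ i j, ContDiffAt ℝ ∞ (fun q => G q i j) p)
    (hd : (G p).det ≠ 0) :
    dirDeriv v (fun q => (G q).det) p =
      (G p).det * ∑ i, ∑ j, (G p)⁻¹ i j * dirDeriv v (fun q => G q j i) p := by
  have h1 : ∀ σ : Equiv.Perm (Fin n), dirDeriv v (fun q => ∏ i, G q (σ i) i) p =
      ∑ k, (∏ j ∈ Finset.univ.erase k, G p (σ j) j) * dirDeriv v (fun q => G q (σ k) k) p := by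
    intro σ
    have h := HasFDerivAt.finsetProd (u := Finset.univ) (x := p)
      (g := fun i q => G q (σ i) i) (g' := fun i => fderiv ℝ (fun q => G q (σ i) i) p)
      fun i _ => (hG (σ i) i).diff.hasFDerivAt
    simp only [dirDeriv]
    rw [h.fderiv]
    simp
  have hprod : ∀ σ : Equiv.Perm (Fin n), ContDiffAt ℝ ∞ (fun q => ∏ i, G q (σ i) i) p :=
    fun σ => contDiffAt_prod fun k _ => hG _ _
  have h2 : ∀ k, ∑ σ : Equiv.Perm (Fin n), ((Equiv.Perm.sign σ : ℤ) : ℝ) *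
      ((∏ j ∈ Finset.univ.erase k, G p (σ j) j) * dirDeriv v (fun q => G q (σ k) k) p) =
      ∑ j, (G p).adjugate k j * dirDeriv v (fun q => G q j k) p := by
    intro k
    have h3 : ((G p).updateCol k fun j => dirDeriv v (fun q => G q j k) p).det =
        ((G p).adjugate.mulVec fun j => dirDeriv v (fun q => G q j k) p) k := by
      rw [← Matrix.cramer_eq_adjugate_mulVec, Matrix.cramer_apply]
    rw [Matrix.mulVec, dotProduct] at h3
    rw [← h3, Matrix.det_apply']
    refine Finset.sum_congr rfl fun σ _ => ?_
    rw [← Finset.prod_erase_mul _ _ (Finset.mem_univ k)]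
    congr 2
    · exact Finset.prod_congr rfl fun j hj => by simp [Finset.ne_of_mem_erase hj]
    · simp
  have hadj : (G p).adjugate = (G p).det • (G p)⁻¹ := by
    rw [Matrix.inv_def, Ring.inverse_eq_inv', smul_smul, mul_inv_cancel₀ hd, one_smul]
  simp only [Matrix.det_apply' (G _)]
  rw [dirDeriv_sum v fun σ _ => ContDiffAt.diff (contDiffAt_const.mul (hprod σ)),
    ← Matrix.det_apply']
  have h5 : ∀ σ : Equiv.Perm (Fin n),
      dirDeriv v (fun q => ((Equiv.Perm.sign σ : ℤ) : ℝ) * ∏ i, G q (σ i) i) p =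
      ∑ k, ((Equiv.Perm.sign σ : ℤ) : ℝ) *
      ((∏ j ∈ Finset.univ.erase k, G p (σ j) j) * dirDeriv v (fun q => G q (σ k) k) p) := by
    intro σ
    rw [dirDeriv_mul v (differentiableAt_const _) (hprod σ).diff, dirDeriv_const, h1,
      Finset.mul_sum]
    simp
  simp only [h5]
  rw [Finset.sum_comm]
  simp only [h2, hadj, Matrix.smul_apply, smul_eq_mul, Finset.mul_sum, mul_assoc]

end Calculus

/-! ### Christoffel symbols and Palatini's formula -/

section Variation

variable {V : Type*} [NormedAddCommGroup V] [NormedSpace ℝ V] {n : ℕ}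

/-- The Christoffel symbols of the matrix field `G` on `V`, formed with the derivatives in the
directions `e₁, …, eₙ`. For `V = ℝⁿ` and the standard basis these are the usual ones; for
`V = ℝ × ℝⁿ` they are those of a family of metrics depending on a parameter. -/
def christoffelAlong (e : Fin n → V) (G : V → Matrix (Fin n) (Fin n) ℝ) (k i j : Fin n) (p : V) :
    ℝ :=
  1 / 2 * ∑ l, (G p)⁻¹ k l * (dirDeriv (e i) (fun q => G q j l) p
    + dirDeriv (e j) (fun q => G q i l) p - dirDeriv (e l) (fun q => G q i j) p)

/-- The Ricci tensor of the matrix field `G` on `V`, formed with the derivatives in the directions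
`e₁, …, eₙ`. -/
def ricciAlong (e : Fin n → V) (G : V → Matrix (Fin n) (Fin n) ℝ) (p : V) :
    Matrix (Fin n) (Fin n) ℝ :=
  Matrix.of fun i j =>
    ∑ k, (dirDeriv (e k) (christoffelAlong e G k i j) p
      - dirDeriv (e j) (christoffelAlong e G k i k) p) +
    ∑ k, ∑ l, (christoffelAlong e G k k l p * christoffelAlong e G l i j p
      - christoffelAlong e G k j l p * christoffelAlong e G l i k p)

variable {e : Fin n → V} {G : V → Matrix (Fin n) (Fin n) ℝ} {p : V}

lemma contDiffAt_christoffelAlong (hG : ∀ i j, ContDiffAt ℝ ∞ (fun q => G q i j) p)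
    (hd : (G p).det ≠ 0) (k i j : Fin n) : ContDiffAt ℝ ∞ (christoffelAlong e G k i j) p := by
  unfold christoffelAlong
  exact contDiffAt_const.mul (ContDiffAt.sum fun l _ => (contDiffAt_inv hG hd k l).mul
    (((contDiffAt_dirDeriv _ (hG j l)).add (contDiffAt_dirDeriv _ (hG i l))).sub
      (contDiffAt_dirDeriv _ (hG i j))))

lemma contDiffAt_ricciAlong (hG : ∀ i j, ContDiffAt ℝ ∞ (fun q => G q i j) p)
    (hd : (G p).det ≠ 0) (i j : Fin n) : ContDiffAt ℝ ∞ (fun q => ricciAlong e G q i j) p := by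
  have h := fun k i j => contDiffAt_christoffelAlong (e := e) hG hd k i j
  simp only [ricciAlong, Matrix.of_apply]
  refine (ContDiffAt.sum fun k _ => (contDiffAt_dirDeriv _ (h k i j)).sub
    (contDiffAt_dirDeriv _ (h k i k))).add
    (ContDiffAt.sum fun k _ => ContDiffAt.sum fun l _ => ((h k k l).mul (h l i j)).sub
      ((h k j l).mul (h l i k)))

lemma dirDeriv_symm (v : V) (hS : ∀ᶠ q in nhds p, (G q).IsSymm) (i j : Fin n) :
    dirDeriv v (fun q => G q i j) p = dirDeriv v (fun q => G q j i) p :=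
  dirDeriv_congr v (hS.mono fun _ h => h.apply j i)

lemma christoffelAlong_symm (hS : ∀ᶠ q in nhds p, (G q).IsSymm) (k i j : Fin n) :
    christoffelAlong e G k i j p = christoffelAlong e G k j i p := by
  unfold christoffelAlong
  congr 1
  refine Finset.sum_congr rfl fun l _ => ?_
  rw [dirDeriv_symm (e l) hS i j]
  ring

/-- Lowering the upper index of the Christoffel symbol. -/
lemma sum_mul_christoffelAlong (hd : (G p).det ≠ 0) (b i j : Fin n) :
    ∑ a, G p b a * christoffelAlong e G a i j p =
      1 / 2 * (dirDeriv (e i) (fun q => G q j b) p + dirDeriv (e j) (fun q => G q i b) p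
        - dirDeriv (e b) (fun q => G q i j) p) := by
  set w : Fin n → ℝ := fun l => dirDeriv (e i) (fun q => G q j l) p
    + dirDeriv (e j) (fun q => G q i l) p - dirDeriv (e l) (fun q => G q i j) p
  have h : (G p).mulVec ((G p)⁻¹.mulVec w) = w := by
    rw [Matrix.mulVec_mulVec, Matrix.mul_nonsing_inv _ (isUnit_iff_ne_zero.2 hd),
      Matrix.one_mulVec]
  change _ = 1 / 2 * w b
  rw [← h]
  simp only [Matrix.mulVec, dotProduct, Finset.mul_sum, christoffelAlong]
  refine Finset.sum_congr rfl fun a _ => Finset.sum_congr rfl fun l _ => ?_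
  simp only [w]
  ring

/-- The metric is parallel: `∂ₖ G = G Γₖ + Γₖᵀ G` for the matrix `Γₖ = (Γⁱₖⱼ)ᵢⱼ`. -/
lemma dirDeriv_metric (hS : ∀ᶠ q in nhds p, (G q).IsSymm) (hd : (G p).det ≠ 0) (k : Fin n) :
    (Matrix.of fun i j => dirDeriv (e k) (fun q => G q i j) p) =
      G p * (Matrix.of fun i j => christoffelAlong e G i k j p) +
      (Matrix.of fun i j => christoffelAlong e G i k j p).transpose * G p := by
  ext i j
  have hs : (G p).IsSymm := hS.self_of_nhds
  have h1 := sum_mul_christoffelAlong (e := e) hd i k j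
  have h2 := sum_mul_christoffelAlong (e := e) hd j k i
  simp only [Matrix.add_apply, Matrix.mul_apply, Matrix.of_apply, Matrix.transpose_apply]
  have h3 : ∑ a, christoffelAlong e G a k i p * G p a j =
      ∑ a, G p j a * christoffelAlong e G a k i p :=
    Finset.sum_congr rfl fun a _ => by rw [hs.apply j a, mul_comm]
  rw [h3, h1, h2, dirDeriv_symm (e k) hS j i, dirDeriv_symm (e j) hS k i,
    dirDeriv_symm (e i) hS k j]
  ring

/-- The inverse metric is parallel, in components. -/
lemma dirDeriv_inv_metric (hG : ∀ i j, ContDiffAt ℝ ∞ (fun q => G q i j) p)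
    (hS : ∀ᶠ q in nhds p, (G q).IsSymm) (hd : (G p).det ≠ 0) (k i j : Fin n) :
    dirDeriv (e k) (fun q => (G q)⁻¹ i j) p =
      -∑ l, ((G p)⁻¹ i l * christoffelAlong e G j k l p
        + (G p)⁻¹ j l * christoffelAlong e G i k l p) := by
  have hs : (G p)⁻¹.IsSymm := by
    have : (G p).IsSymm := hS.self_of_nhds
    rw [Matrix.IsSymm, Matrix.transpose_nonsing_inv, this.eq]
  have hu : IsUnit (G p).det := isUnit_iff_ne_zero.2 hd
  set T : Matrix (Fin n) (Fin n) ℝ := Matrix.of fun i j => christoffelAlong e G i k j p with hT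
  have h1 : dirDeriv (e k) (fun q => (G q)⁻¹ i j) p = -((G p)⁻¹ *
      (Matrix.of fun i j => dirDeriv (e k) (fun q => G q i j) p) * (G p)⁻¹) i j := by
    rw [dirDeriv_inv (e k) hG hd, Matrix.mul_apply, Finset.sum_comm]
    simp only [Matrix.mul_apply, Finset.sum_mul, Matrix.of_apply]
  rw [h1, dirDeriv_metric hS hd k, ← hT, Matrix.mul_add, Matrix.add_mul, ← Matrix.mul_assoc,
    Matrix.nonsing_inv_mul _ hu, one_mul, Matrix.mul_assoc, Matrix.mul_assoc,
    Matrix.mul_nonsing_inv _ hu, mul_one, Matrix.add_apply, Matrix.mul_apply, Matrix.mul_apply,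
    ← Finset.sum_add_distrib]
  congr 1
  refine Finset.sum_congr rfl fun l _ => ?_
  rw [hs.apply j l]
  simp only [hT, Matrix.transpose_apply, Matrix.of_apply]
  ring

/-- The contracted Christoffel symbol is the logarithmic derivative of the volume coefficient. -/
lemma dirDeriv_volume (hG : ∀ i j, ContDiffAt ℝ ∞ (fun q => G q i j) p)
    (hS : ∀ᶠ q in nhds p, (G q).IsSymm) (hd : (G p).det ≠ 0) {m : V → ℝ}
    (hm : ContDiffAt ℝ ∞ m p) (hdet : ∀ᶠ q in nhds p, (G q).det = m q ^ 2) (k : Fin n) :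
    dirDeriv (e k) m p = m p * ∑ l, christoffelAlong e G l k l p := by
  have hu : IsUnit (G p).det := isUnit_iff_ne_zero.2 hd
  set T : Matrix (Fin n) (Fin n) ℝ := Matrix.of fun i j => christoffelAlong e G i k j p with hT
  have hp : (G p).det = m p ^ 2 := hdet.self_of_nhds
  have hm0 : m p ≠ 0 := by
    intro h
    rw [hp, h] at hd
    simp at hd
  have h1 := dirDeriv_det (e k) hG hd
  have h2 : dirDeriv (e k) (fun q => (G q).det) p = 2 * m p * dirDeriv (e k) m p := by
    rw [dirDeriv_congr (e k) (g := fun q => m q * m q) (hdet.mono fun q h => by rw [h]; ring),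
      dirDeriv_mul _ hm.diff hm.diff]
    ring
  have h3 : ∑ i, ∑ j, (G p)⁻¹ i j * dirDeriv (e k) (fun q => G q j i) p =
      ((G p)⁻¹ * Matrix.of fun i j => dirDeriv (e k) (fun q => G q i j) p).trace := by
    simp [Matrix.trace, Matrix.mul_apply]
  have h4 : ((G p)⁻¹ * Matrix.of fun i j => dirDeriv (e k) (fun q => G q i j) p).trace =
      2 * T.trace := by
    rw [dirDeriv_metric hS hd k, ← hT, Matrix.mul_add, ← Matrix.mul_assoc,
      Matrix.nonsing_inv_mul _ hu, one_mul, Matrix.trace_add, Matrix.trace_mul_comm,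
      Matrix.mul_assoc, Matrix.mul_nonsing_inv _ hu, mul_one, Matrix.trace_transpose]
    ring
  have h5 : ∑ l, christoffelAlong e G l k l p = T.trace := by simp [Matrix.trace, hT]
  rw [h3, h4, h2, hp] at h1
  rw [h5]
  have : 2 * m p * dirDeriv (e k) m p = 2 * m p * (m p * T.trace) := by rw [h1]; ring
  exact mul_left_cancel₀ (mul_ne_zero two_ne_zero hm0) this

/-- The pointwise algebra behind the first variation of scalar curvature: contracting the Palatini
formula for `δRic` with the inverse metric `g` gives a divergence. Here `A = Γ`, `B = δΓ`,
`dB c = ∂_c B`, `dg c = ∂_c g`, and `L` is the contracted Christoffel symbol. -/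
lemma palatini_algebra {g : Fin n → Fin n → ℝ} {A B : Fin n → Fin n → Fin n → ℝ}
    {dg : Fin n → Fin n → Fin n → ℝ} {dB : Fin n → Fin n → Fin n → Fin n → ℝ} {m : ℝ}
    {dm L : Fin n → ℝ} (hg : ∀ i j, g i j = g j i) (hA : ∀ k i j, A k i j = A k j i)
    (hB : ∀ k i j, B k i j = B k j i) (hL : ∀ l, ∑ k, A k k l = L l)
    (hB0 : ∀ l, ∑ k, B k k l = 0) (hdB0 : ∀ i j, ∑ k, dB j k i k = 0)
    (hm : ∀ k, dm k = m * L k)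
    (hdg : ∀ k i j, dg k i j = -∑ l, (g i l * A j k l + g j l * A i k l)) :
    ∑ i, ∑ j, g i j * (∑ k, (dB k k i j - dB j k i k) +
      ∑ k, ∑ l, ((B k k l * A l i j + A k k l * B l i j)
        - (B k j l * A l i k + A k j l * B l i k))) * m =
    ∑ k, ∑ i, ∑ j, (dm k * (g i j * B k i j) + m * (dg k i j * B k i j + g i j * dB k k i j)) := by
  set C : ℝ := ∑ k, ∑ i, ∑ j, ∑ l, g i j * B k j l * A l i k with hC
  have e1 : ∑ k, ∑ i, ∑ j, dg k i j * B k i j = -(2 * C) := by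
    have s : ∀ k, ∑ i, ∑ j, ∑ l, g j l * A i k l * B k i j =
        ∑ i, ∑ j, ∑ l, g i l * A j k l * B k i j := fun k => by
      rw [Finset.sum_comm]
      refine Finset.sum_congr rfl fun i _ => Finset.sum_congr rfl fun j _ =>
        Finset.sum_congr rfl fun l _ => ?_
      rw [hB k j i]
    have s' : ∀ k, ∑ i, ∑ j, ∑ l, g i l * A j k l * B k i j =
        ∑ i, ∑ j, ∑ l, g i j * B k j l * A l i k := fun k => by
      calc _ = ∑ i, ∑ l, ∑ j, g i l * A j k l * B k i j :=
            Finset.sum_congr rfl fun i _ => Finset.sum_comm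
        _ = _ := by
            rw [Finset.sum_comm]
            refine Finset.sum_congr rfl fun i _ => Finset.sum_congr rfl fun j _ =>
              Finset.sum_congr rfl fun l _ => ?_
            rw [hg j i, hA l k i]
            ring
    simp only [hdg, neg_mul, Finset.sum_neg_distrib, Finset.sum_mul, add_mul,
      Finset.sum_add_distrib, s, s']
    rw [hC]
    ring
  have e2 : ∀ i j, ∑ k, (dB k k i j - dB j k i k) +
      ∑ k, ∑ l, ((B k k l * A l i j + A k k l * B l i j)
        - (B k j l * A l i k + A k j l * B l i k)) =
      ∑ k, dB k k i j + ∑ k, L k * B k i j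
        - ∑ k, ∑ l, (B k j l * A l i k + B k i l * A l j k) := by
    intro i j
    have t1 : ∑ k, ∑ l, B k k l * A l i j = 0 := by
      rw [Finset.sum_comm]
      simp [← Finset.sum_mul, hB0]
    have t2 : ∑ k, ∑ l, A k k l * B l i j = ∑ l, L l * B l i j := by
      rw [Finset.sum_comm]
      simp [← Finset.sum_mul, hL]
    have t3 : ∑ k, ∑ l, A k j l * B l i k = ∑ k, ∑ l, B k i l * A l j k := by
      rw [Finset.sum_comm]
      simp only [mul_comm]
    simp only [Finset.sum_sub_distrib, Finset.sum_add_distrib, t1, t2, t3, hdB0]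
    ring
  have e3 : ∑ i, ∑ j, ∑ k, ∑ l, g i j * (B k j l * A l i k) = C := by
    rw [hC]
    calc _ = ∑ i, ∑ k, ∑ j, ∑ l, g i j * (B k j l * A l i k) :=
          Finset.sum_congr rfl fun i _ => Finset.sum_comm
      _ = _ := by
          rw [Finset.sum_comm]
          simp only [mul_assoc]
  have e4 : ∑ i, ∑ j, ∑ k, ∑ l, g i j * (B k i l * A l j k) = C := by
    rw [← e3, Finset.sum_comm]
    refine Finset.sum_congr rfl fun i _ => Finset.sum_congr rfl fun j _ => ?_
    rw [hg j i]
  have e5 : ∑ i, ∑ j, ∑ k, g i j * dB k k i j = ∑ k, ∑ i, ∑ j, g i j * dB k k i j := by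
    rw [Finset.sum_comm_cycle]
  have e6 : ∑ i, ∑ j, ∑ k, g i j * (L k * B k i j) = ∑ k, ∑ i, ∑ j, g i j * (L k * B k i j) := by
    rw [Finset.sum_comm_cycle]
  have lhs : ∑ i, ∑ j, g i j * (∑ k, dB k k i j + ∑ k, L k * B k i j
        - ∑ k, ∑ l, (B k j l * A l i k + B k i l * A l j k)) * m =
      (∑ k, ∑ i, ∑ j, g i j * dB k k i j + ∑ k, ∑ i, ∑ j, g i j * (L k * B k i j)
        - (C + C)) * m := by
    simp only [← Finset.sum_mul, mul_add, mul_sub, Finset.mul_sum, Finset.sum_add_distrib,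
      Finset.sum_sub_distrib, e3, e4, e5, e6]
  have rhs : ∑ k, ∑ i, ∑ j, (dm k * (g i j * B k i j)
        + m * (dg k i j * B k i j + g i j * dB k k i j)) =
      m * (∑ k, ∑ i, ∑ j, g i j * (L k * B k i j)) + m * (-(2 * C)) +
        m * ∑ k, ∑ i, ∑ j, g i j * dB k k i j := by
    rw [← e1]
    simp only [Finset.mul_sum, ← Finset.sum_add_distrib]
    refine Finset.sum_congr rfl fun k _ => Finset.sum_congr rfl fun i _ =>
      Finset.sum_congr rfl fun j _ => ?_
    rw [hm]
    ring
  simp only [e2]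
  rw [lhs, rhs]
  ring

end Variation

/-! ### The first variation of scalar curvature -/

section Variation

variable {V : Type*} [NormedAddCommGroup V] [NormedSpace ℝ V] {n : ℕ}
variable {e : Fin n → V} {G : V → Matrix (Fin n) (Fin n) ℝ} {p : V}

/-- The scalar curvature of the matrix field `G` on `V`, formed with the derivatives in the
directions `e₁, …, eₙ`. -/
def scalarAlong (e : Fin n → V) (G : V → Matrix (Fin n) (Fin n) ℝ) (p : V) : ℝ :=
  ∑ i, ∑ j, (G p)⁻¹ i j * ricciAlong e G p i j

/-- The components `m gⁱʲ ∂_τ Γᵏᵢⱼ` of the vector density whose divergence appears in the first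
variation, in the direction `τ`, of the scalar curvature density. -/
def variationField (e : Fin n → V) (G : V → Matrix (Fin n) (Fin n) ℝ) (m : V → ℝ) (τ : V)
    (k : Fin n) (p : V) : ℝ :=
  m p * ∑ i, ∑ j, (G p)⁻¹ i j * dirDeriv τ (christoffelAlong e G k i j) p

lemma contDiffAt_variationField (hG : ∀ i j, ContDiffAt ℝ ∞ (fun q => G q i j) p)
    (hd : (G p).det ≠ 0) {m : V → ℝ} (hm : ContDiffAt ℝ ∞ m p) (τ : V) (k : Fin n) :
    ContDiffAt ℝ ∞ (variationField e G m τ k) p := by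
  unfold variationField
  exact hm.mul (ContDiffAt.sum fun i _ => ContDiffAt.sum fun j _ => (contDiffAt_inv hG hd i j).mul
    (contDiffAt_dirDeriv τ (contDiffAt_christoffelAlong hG hd k i j)))

lemma contDiffAt_scalarAlong (hG : ∀ i j, ContDiffAt ℝ ∞ (fun q => G q i j) p)
    (hd : (G p).det ≠ 0) : ContDiffAt ℝ ∞ (scalarAlong e G) p := by
  unfold scalarAlong
  exact ContDiffAt.sum fun i _ => ContDiffAt.sum fun j _ => (contDiffAt_inv hG hd i j).mul
    (contDiffAt_ricciAlong hG hd i j)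

lemma dirDeriv_ricciAlong (hG : ∀ i j, ContDiffAt ℝ ∞ (fun q => G q i j) p)
    (hd : (G p).det ≠ 0) (τ : V) (i j : Fin n) :
    dirDeriv τ (fun q => ricciAlong e G q i j) p =
      ∑ k, (dirDeriv (e k) (dirDeriv τ (christoffelAlong e G k i j)) p
        - dirDeriv (e j) (dirDeriv τ (christoffelAlong e G k i k)) p) +
      ∑ k, ∑ l, ((dirDeriv τ (christoffelAlong e G k k l) p * christoffelAlong e G l i j p
          + christoffelAlong e G k k l p * dirDeriv τ (christoffelAlong e G l i j) p)
        - (dirDeriv τ (christoffelAlong e G k j l) p * christoffelAlong e G l i k p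
          + christoffelAlong e G k j l p * dirDeriv τ (christoffelAlong e G l i k) p)) := by
  have h := fun k i j => contDiffAt_christoffelAlong (e := e) hG hd k i j
  have h' := fun v k i j => contDiffAt_dirDeriv v (h k i j)
  simp only [ricciAlong, Matrix.of_apply]
  rw [dirDeriv_add τ
    (ContDiffAt.diff (ContDiffAt.sum fun k _ => (h' (e k) k i j).sub (h' (e j) k i k)))
    (ContDiffAt.diff (ContDiffAt.sum fun k _ => ContDiffAt.sum fun l _ =>
      ((h k k l).mul (h l i j)).sub ((h k j l).mul (h l i k)))),
    dirDeriv_sum τ fun k _ => ContDiffAt.diff ((h' (e k) k i j).sub (h' (e j) k i k)),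
    dirDeriv_sum τ fun k _ => ContDiffAt.diff (ContDiffAt.sum fun l _ =>
      ((h k k l).mul (h l i j)).sub ((h k j l).mul (h l i k)))]
  congr 1
  · refine Finset.sum_congr rfl fun k _ => ?_
    rw [dirDeriv_sub τ (h' (e k) k i j).diff (h' (e j) k i k).diff, dirDeriv_comm _ _ (h k i j),
      dirDeriv_comm _ _ (h k i k)]
  · refine Finset.sum_congr rfl fun k _ => ?_
    rw [dirDeriv_sum τ fun l _ => ContDiffAt.diff
      (((h k k l).mul (h l i j)).sub ((h k j l).mul (h l i k)))]
    refine Finset.sum_congr rfl fun l _ => ?_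
    rw [dirDeriv_sub τ (ContDiffAt.diff ((h k k l).mul (h l i j)))
      (ContDiffAt.diff ((h k j l).mul (h l i k))),
      dirDeriv_mul τ (h k k l).diff (h l i j).diff, dirDeriv_mul τ (h k j l).diff (h l i k).diff]

/-- When the volume coefficient `m` does not vary in the direction `τ`, neither does the contracted
Christoffel symbol. -/
lemma sum_dirDeriv_christoffelAlong {W : Set V} (hW : IsOpen W)
    (hG : ∀ q ∈ W, ∀ i j, ContDiffAt ℝ ∞ (fun q => G q i j) q)
    (hS : ∀ q ∈ W, (G q).IsSymm) (hd : ∀ q ∈ W, (G q).det ≠ 0) {m : V → ℝ}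
    (hm : ∀ q ∈ W, ContDiffAt ℝ ∞ m q) (hdet : ∀ q ∈ W, (G q).det = m q ^ 2) {τ : V}
    (hτ : ∀ q ∈ W, dirDeriv τ m q = 0) (hp : p ∈ W) (i : Fin n) :
    ∑ k, dirDeriv τ (christoffelAlong e G k i k) p = 0 := by
  have hWp := hW.mem_nhds hp
  have hS' : ∀ q ∈ W, ∀ᶠ q' in nhds q, (G q').IsSymm := fun q hq =>
    Filter.mem_of_superset (hW.mem_nhds hq) hS
  have hdet' : ∀ q ∈ W, ∀ᶠ q' in nhds q, (G q').det = m q' ^ 2 := fun q hq =>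
    Filter.mem_of_superset (hW.mem_nhds hq) hdet
  have hm0 : m p ≠ 0 := fun h => hd p hp (by rw [hdet p hp, h]; simp)
  have hΓ := fun k i j => contDiffAt_christoffelAlong (e := e) (hG p hp) (hd p hp) k i j
  have h1 : dirDeriv τ (dirDeriv (e i) m) p =
      dirDeriv τ (fun q => m q * ∑ l, christoffelAlong e G l i l q) p :=
    dirDeriv_congr τ (Filter.mem_of_superset hWp fun q hq =>
      dirDeriv_volume (hG q hq) (hS' q hq) (hd q hq) (hm q hq) (hdet' q hq) i)
  have h2 : dirDeriv τ (dirDeriv (e i) m) p = 0 := by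
    rw [dirDeriv_comm _ _ (hm p hp), dirDeriv_congr (e i) (g := fun _ => 0)
      (Filter.mem_of_superset hWp hτ), dirDeriv_const]
  rw [h2, dirDeriv_mul τ (hm p hp).diff (ContDiffAt.diff (ContDiffAt.sum fun l _ => hΓ l i l)),
    hτ p hp, dirDeriv_sum τ fun l _ => (hΓ l i l).diff, zero_mul, zero_add] at h1
  exact (mul_eq_zero.1 h1.symm).resolve_left hm0

/-- The pairing as a contraction against `A⁻¹ H A⁻¹`. -/
lemma sum_inv_mul_mul_inv_mul {A : Matrix (Fin n) (Fin n) ℝ} (hA : A.IsSymm)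
    (H R : Matrix (Fin n) (Fin n) ℝ) :
    ∑ i, ∑ j, (∑ a, ∑ b, A⁻¹ i a * H a b * A⁻¹ b j) * R i j = pairing A H R := by
  have hs : A⁻¹.IsSymm := by rw [Matrix.IsSymm, Matrix.transpose_nonsing_inv, hA.eq]
  have h : ∀ i a j b, A⁻¹ i a * H a b * A⁻¹ b j * R i j =
      A⁻¹ a i * A⁻¹ b j * H a b * R i j := fun i a j b => by
    rw [hs.apply a i]
    ring
  simp only [Finset.sum_mul, h, pairing]
  rw [Finset.sum_comm_cycle]
  exact Finset.sum_congr rfl fun a _ => Finset.sum_comm_cycle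

/-- The first variation of the scalar curvature density with fixed volume density `m`: it is
`-⟨∂_τ g, Ric⟩ m` plus the divergence of `variationField`. -/
lemma dirDeriv_scalarAlong {W : Set V} (hW : IsOpen W)
    (hG : ∀ q ∈ W, ∀ i j, ContDiffAt ℝ ∞ (fun q => G q i j) q)
    (hS : ∀ q ∈ W, (G q).IsSymm) (hd : ∀ q ∈ W, (G q).det ≠ 0) {m : V → ℝ}
    (hm : ∀ q ∈ W, ContDiffAt ℝ ∞ m q) (hdet : ∀ q ∈ W, (G q).det = m q ^ 2) {τ : V}
    (hτ : ∀ q ∈ W, dirDeriv τ m q = 0) (hp : p ∈ W) :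
    dirDeriv τ (fun q => scalarAlong e G q * m q) p =
      -(pairing (G p) (Matrix.of fun i j => dirDeriv τ (fun q => G q i j) p)
          (ricciAlong e G p) * m p) +
        ∑ k, dirDeriv (e k) (variationField e G m τ k) p := by
  have hWp := hW.mem_nhds hp
  have hS' : ∀ q ∈ W, ∀ᶠ q' in nhds q, (G q').IsSymm := fun q hq =>
    Filter.mem_of_superset (hW.mem_nhds hq) hS
  have hdet' : ∀ q ∈ W, ∀ᶠ q' in nhds q, (G q').det = m q' ^ 2 := fun q hq =>
    Filter.mem_of_superset (hW.mem_nhds hq) hdet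
  have hGp := hG p hp
  have hdp := hd p hp
  have hI := contDiffAt_inv hGp hdp
  have hR := contDiffAt_ricciAlong (e := e) hGp hdp
  have hΓ := fun k i j => contDiffAt_christoffelAlong (e := e) hGp hdp k i j
  have hΓτ := fun k i j => contDiffAt_dirDeriv τ (hΓ k i j)
  have hs : (G p)⁻¹.IsSymm := by
    rw [Matrix.IsSymm, Matrix.transpose_nonsing_inv, (hS p hp).eq]
  have hsymm : ∀ q ∈ W, ∀ k i j, christoffelAlong e G k i j q = christoffelAlong e G k j i q :=
    fun q hq k i j => christoffelAlong_symm (hS' q hq) k i j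
  have hBsymm : ∀ q ∈ W, ∀ k i j, dirDeriv τ (christoffelAlong e G k i j) q =
      dirDeriv τ (christoffelAlong e G k j i) q := fun q hq k i j =>
    dirDeriv_congr τ (Filter.mem_of_superset (hW.mem_nhds hq) fun q' hq' => hsymm q' hq' k i j)
  have htr : ∀ q ∈ W, ∀ i, ∑ k, dirDeriv τ (christoffelAlong e G k i k) q = 0 :=
    fun q hq i => sum_dirDeriv_christoffelAlong hW hG hS hd hm hdet hτ hq i
  have hdtr : ∀ i j, ∑ k, dirDeriv (e j) (dirDeriv τ (christoffelAlong e G k i k)) p = 0 := by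
    intro i j
    rw [← dirDeriv_sum (e j) fun k _ => (hΓτ k i k).diff,
      dirDeriv_congr (e j) (g := fun _ => 0) (Filter.mem_of_superset hWp fun q hq => htr q hq i),
      dirDeriv_const]
  have halg := palatini_algebra (g := fun i j => (G p)⁻¹ i j)
    (A := fun k i j => christoffelAlong e G k i j p)
    (B := fun k i j => dirDeriv τ (christoffelAlong e G k i j) p)
    (dg := fun k i j => dirDeriv (e k) (fun q => (G q)⁻¹ i j) p)
    (dB := fun c k i j => dirDeriv (e c) (dirDeriv τ (christoffelAlong e G k i j)) p)
    (m := m p) (dm := fun k => dirDeriv (e k) m p)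
    (L := fun k => ∑ l, christoffelAlong e G l k l p)
    (fun i j => hs.apply j i) (hsymm p hp) (hBsymm p hp)
    (fun l => Finset.sum_congr rfl fun k _ => hsymm p hp k k l)
    (fun l => by rw [← htr p hp l]; exact Finset.sum_congr rfl fun k _ => hBsymm p hp k k l)
    hdtr (fun k => dirDeriv_volume hGp (hS' p hp) hdp (hm p hp) (hdet' p hp) k)
    (fun k i j => dirDeriv_inv_metric hGp (hS' p hp) hdp k i j)
  have hdiv : ∀ k, dirDeriv (e k) (variationField e G m τ k) p =
      ∑ i, ∑ j, (dirDeriv (e k) m p * ((G p)⁻¹ i j * dirDeriv τ (christoffelAlong e G k i j) p)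
        + m p * (dirDeriv (e k) (fun q => (G q)⁻¹ i j) p
            * dirDeriv τ (christoffelAlong e G k i j) p
          + (G p)⁻¹ i j * dirDeriv (e k) (dirDeriv τ (christoffelAlong e G k i j)) p)) := by
    intro k
    unfold variationField
    rw [dirDeriv_mul (e k) (hm p hp).diff (ContDiffAt.diff (ContDiffAt.sum fun i _ =>
        ContDiffAt.sum fun j _ => (hI i j).mul (hΓτ k i j))),
      dirDeriv_sum (e k) fun i _ => ContDiffAt.diff (ContDiffAt.sum fun j _ =>
        (hI i j).mul (hΓτ k i j))]
    simp only [Finset.mul_sum, ← Finset.sum_add_distrib]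
    refine Finset.sum_congr rfl fun i _ => ?_
    rw [dirDeriv_sum (e k) fun j _ => ContDiffAt.diff ((hI i j).mul (hΓτ k i j)), Finset.mul_sum,
      ← Finset.sum_add_distrib]
    refine Finset.sum_congr rfl fun j _ => ?_
    rw [dirDeriv_mul (e k) (hI i j).diff (hΓτ k i j).diff]
  simp only [hdiv]
  rw [← halg]
  have hpair : ∑ i, ∑ j, dirDeriv τ (fun q => (G q)⁻¹ i j) p * ricciAlong e G p i j =
      -pairing (G p) (Matrix.of fun i j => dirDeriv τ (fun q => G q i j) p)
          (ricciAlong e G p) := by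
    rw [← sum_inv_mul_mul_inv_mul (hS p hp)]
    simp only [dirDeriv_inv τ hGp hdp, neg_mul, Finset.sum_neg_distrib, Matrix.of_apply]
  have hscal : dirDeriv τ (scalarAlong e G) p =
      ∑ i, ∑ j, dirDeriv τ (fun q => (G q)⁻¹ i j) p * ricciAlong e G p i j +
      ∑ i, ∑ j, (G p)⁻¹ i j * dirDeriv τ (fun q => ricciAlong e G q i j) p := by
    unfold scalarAlong
    rw [dirDeriv_sum τ fun i _ => ContDiffAt.diff (ContDiffAt.sum fun j _ =>
      (hI i j).mul (hR i j)), ← Finset.sum_add_distrib]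
    refine Finset.sum_congr rfl fun i _ => ?_
    rw [dirDeriv_sum τ fun j _ => ContDiffAt.diff ((hI i j).mul (hR i j)),
      ← Finset.sum_add_distrib]
    refine Finset.sum_congr rfl fun j _ => ?_
    rw [dirDeriv_mul τ (hI i j).diff (hR i j).diff]
  rw [dirDeriv_mul τ (contDiffAt_scalarAlong hGp hdp).diff (hm p hp).diff, hτ p hp, mul_zero,
    add_zero, hscal, hpair, add_mul, neg_mul]
  congr 1
  simp only [Finset.sum_mul, dirDeriv_ricciAlong hGp hdp]

end Variation

/-! ### Restriction to a time slice and change of coordinates -/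

section Slice

variable {n : ℕ}

/-- The spatial coordinate directions in `ℝ × ℝⁿ`. -/
def spatial (i : Fin n) : ℝ × Coord n := (0, EuclideanSpace.single i 1)

/-- A spatial derivative at fixed time is a directional derivative in `ℝ × ℝⁿ`. -/
lemma pderiv_slice {F : ℝ × Coord n → ℝ} {t : ℝ} {y : Coord n} (i : Fin n)
    (hF : DifferentiableAt ℝ F (t, y)) :
    pderiv i (fun z => F (t, z)) y = dirDeriv (spatial i) F (t, y) := by
  have h : HasFDerivAt (fun z : Coord n => F (t, z))
      ((fderiv ℝ F (t, y)).comp (ContinuousLinearMap.inr ℝ ℝ (Coord n))) y :=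
    hF.hasFDerivAt.comp y (hasFDerivAt_prodMk_right t y)
  simp [pderiv, h.fderiv, dirDeriv, spatial]

lemma deriv_slice {F : ℝ × Coord n → ℝ} {t : ℝ} {y : Coord n}
    (hF : DifferentiableAt ℝ F (t, y)) :
    HasDerivAt (fun s => F (s, y)) (dirDeriv (1, 0) F (t, y)) t := by
  have h : HasFDerivAt (fun s : ℝ => F (s, y))
      ((fderiv ℝ F (t, y)).comp (ContinuousLinearMap.inl ℝ ℝ (Coord n))) t :=
    hF.hasFDerivAt.comp t (hasFDerivAt_prodMk_left t y)
  simpa [dirDeriv] using h.hasDerivAt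

variable {G : ℝ × Coord n → Matrix (Fin n) (Fin n) ℝ} {t : ℝ} {y : Coord n}

lemma christoffel_slice (hG : ∀ i j, ContDiffAt ℝ ∞ (fun q => G q i j) (t, y)) (k i j : Fin n) :
    christoffel (fun z => G (t, z)) k i j y = christoffelAlong spatial G k i j (t, y) := by
  unfold christoffel christoffelAlong
  congr 1
  refine Finset.sum_congr rfl fun l _ => ?_
  rw [pderiv_slice i (hG j l).diff, pderiv_slice j (hG i l).diff, pderiv_slice l (hG i j).diff]

lemma ricci_slice {W : Set (ℝ × Coord n)} (hW : IsOpen W)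
    (hG : ∀ q ∈ W, ∀ i j, ContDiffAt ℝ ∞ (fun q => G q i j) q)
    (hd : ∀ q ∈ W, (G q).det ≠ 0) (hp : (t, y) ∈ W) :
    ricci (fun z => G (t, z)) y = ricciAlong spatial G (t, y) := by
  have hmem : ∀ᶠ z in nhds y, (t, z) ∈ W :=
    (Continuous.prodMk_right t).continuousAt.eventually (hW.mem_nhds hp)
  have hΓ := fun k i j => contDiffAt_christoffelAlong (e := spatial) (hG _ hp) (hd _ hp) k i j
  have h : ∀ l k i j, pderiv l (christoffel (fun z => G (t, z)) k i j) y =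
      dirDeriv (spatial l) (christoffelAlong spatial G k i j) (t, y) := by
    intro l k i j
    rw [← pderiv_slice l (hΓ k i j).diff]
    exact dirDeriv_congr _ (hmem.mono fun z hz => christoffel_slice (hG _ hz) k i j)
  ext i j
  simp only [ricci, ricciAlong, Matrix.of_apply, h, christoffel_slice (hG _ hp)]

lemma scalarCurv_slice {W : Set (ℝ × Coord n)} (hW : IsOpen W)
    (hG : ∀ q ∈ W, ∀ i j, ContDiffAt ℝ ∞ (fun q => G q i j) q)
    (hd : ∀ q ∈ W, (G q).det ≠ 0) (hp : (t, y) ∈ W) :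
    scalarCurv (fun z => G (t, z)) y = scalarAlong spatial G (t, y) := by
  simp only [scalarCurv, scalarAlong, ricci_slice hW hG hd hp]

end Slice

section ChangeOfCoordinates

variable {n : ℕ}

/-- The Jacobian matrix `(∂ⱼ Tⁱ)ᵢⱼ` of a map `T` between coordinate spaces. -/
def jacMatrix (T : Coord n → Coord n) (y : Coord n) : Matrix (Fin n) (Fin n) ℝ :=
  Matrix.of fun i j => pderiv j (fun z => T z i) y

lemma contDiffAt_coord {T : Coord n → Coord n} {y : Coord n} (hT : ContDiffAt ℝ ∞ T y)
    (i : Fin n) : ContDiffAt ℝ ∞ (fun z => T z i) y := by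
  exact (contDiffAt_euclidean.1 hT) i

lemma pderiv_comp {T : Coord n → Coord n} {y : Coord n} {f : Coord n → ℝ}
    (hT : ContDiffAt ℝ ∞ T y) (hf : DifferentiableAt ℝ f (T y)) (i : Fin n) :
    pderiv i (fun z => f (T z)) y = ∑ c, jacMatrix T y c i * pderiv c f (T y) := by
  have hT' : DifferentiableAt ℝ T y := hT.differentiableAt (by simp)
  have h1 : fderiv ℝ (fun z => f (T z)) y = (fderiv ℝ f (T y)).comp (fderiv ℝ T y) :=
    fderiv_fun_comp y hf hT'
  have h2 : fderiv ℝ T y (EuclideanSpace.single i 1) =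
      ∑ c, jacMatrix T y c i • EuclideanSpace.single c (1 : ℝ) := by
    ext c
    have h3 : HasFDerivAt (fun z => T z c)
        ((EuclideanSpace.proj c : Coord n →L[ℝ] ℝ).comp (fderiv ℝ T y)) y :=
      (EuclideanSpace.proj c : Coord n →L[ℝ] ℝ).hasFDerivAt.comp y hT'.hasFDerivAt
    simp [jacMatrix, pderiv, h3.fderiv, Finset.sum_apply, Pi.single_apply]
  simp only [pderiv]
  rw [h1, ContinuousLinearMap.comp_apply, h2]
  simp

/-- The transformation law of the Christoffel symbols under a change of coordinates `T`. -/
lemma christoffel_transform {g g' : Coord n → Matrix (Fin n) (Fin n) ℝ} {T : Coord n → Coord n}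
    {y : Coord n} (hT : ContDiffAt ℝ ∞ T y)
    (hg' : ∀ i j, ContDiffAt ℝ ∞ (fun z => g' z i j) (T y))
    (hS' : ∀ᶠ z in nhds (T y), (g' z).IsSymm) (hd : (g y).det ≠ 0)
    (hgg' : ∀ᶠ z in nhds y, g z = (jacMatrix T z).transpose * g' (T z) * jacMatrix T z)
    (d i j : Fin n) :
    ∑ k, jacMatrix T y d k * christoffel g k i j y =
      pderiv i (pderiv j fun z => T z d) y +
        ∑ a, ∑ c, jacMatrix T y a i * jacMatrix T y c j * christoffel g' d a c (T y) := by
  set J := jacMatrix T y with hJ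
  have hs' : (g' (T y)).IsSymm := hS'.self_of_nhds
  have hgy := hgg'.self_of_nhds
  rw [← hJ] at hgy
  have hdJ : J.det ≠ 0 := fun h => hd (by rw [hgy, Matrix.det_mul, h, mul_zero])
  have hd' : (g' (T y)).det ≠ 0 := fun h =>
    hd (by rw [hgy, Matrix.det_mul, Matrix.det_mul, h, mul_zero, zero_mul])
  set H : Fin n → Fin n → Fin n → ℝ := fun a i j => pderiv i (pderiv j fun z => T z a) y with hH
  have hHs : ∀ a i j, H a i j = H a j i := fun a i j => dirDeriv_comm _ _ (contDiffAt_coord hT a)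
  have hJs : ∀ a b, ContDiffAt ℝ ∞ (fun z => jacMatrix T z a b) y := fun a b =>
    contDiffAt_dirDeriv (EuclideanSpace.single b 1) (contDiffAt_coord hT a)
  have hcomp : ∀ a c, ContDiffAt ℝ ∞ (fun z => g' (T z) a c) y := fun a c =>
    ContDiffAt.comp y (hg' a c) hT
  -- the first derivatives of the metric in the old coordinates
  have hdg : ∀ i j b, pderiv i (fun z => g z j b) y =
      ∑ a, ∑ c, (H a i j * J c b * g' (T y) a c + H c i b * J a j * g' (T y) a c
        + ∑ d, J d i * J a j * J c b * pderiv d (fun z => g' z a c) (T y)) := by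
    intro i j b
    have e1 : pderiv i (fun z => g z j b) y = dirDeriv (EuclideanSpace.single i 1)
        (fun z => ∑ a, ∑ c, jacMatrix T z a j * (g' (T z) a c * jacMatrix T z c b)) y := by
      refine dirDeriv_congr _ (hgg'.mono fun z hz => ?_)
      simp only [hz]
      rw [Matrix.mul_assoc, Matrix.mul_apply]
      simp only [Matrix.mul_apply, Matrix.transpose_apply, Finset.mul_sum]
    have hsm : ∀ a c, ContDiffAt ℝ ∞
        (fun z => jacMatrix T z a j * (g' (T z) a c * jacMatrix T z c b)) y := fun a c =>
      (hJs a j).mul ((hcomp a c).mul (hJs c b))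
    rw [e1, dirDeriv_sum _ fun a _ => ContDiffAt.diff (ContDiffAt.sum fun c _ => hsm a c)]
    refine Finset.sum_congr rfl fun a _ => ?_
    rw [dirDeriv_sum _ fun c _ => (hsm a c).diff]
    refine Finset.sum_congr rfl fun c _ => ?_
    rw [dirDeriv_mul _ (hJs a j).diff (ContDiffAt.diff ((hcomp a c).mul (hJs c b))),
      dirDeriv_mul _ (hcomp a c).diff (hJs c b).diff]
    have e2 : dirDeriv (EuclideanSpace.single i 1) (fun z => g' (T z) a c) y =
        ∑ d, J d i * pderiv d (fun z => g' z a c) (T y) := pderiv_comp hT (hg' a c).diff i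
    have e3 : ∀ a j, dirDeriv (EuclideanSpace.single i 1) (fun z => jacMatrix T z a j) y =
        H a i j := fun a j => rfl
    rw [e2, e3, e3, mul_add, Finset.sum_mul, Finset.mul_sum, ← hJ]
    have e4 : ∑ d, J a j * (J d i * pderiv d (fun z => g' z a c) (T y) * J c b) =
        ∑ d, J d i * J a j * J c b * pderiv d (fun z => g' z a c) (T y) :=
      Finset.sum_congr rfl fun d _ => by ring
    rw [e4]
    ring
  -- `h` collects the second derivatives of `T`, and `K` the derivatives of `g'`
  set h : Fin n → Fin n → Fin n → ℝ := fun i j b => ∑ a, ∑ c, H a i j * J c b * g' (T y) a c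
    with hh
  set K : Fin n → Fin n → Fin n → ℝ := fun i j b => ∑ a, ∑ c, ∑ d,
    J d i * J a j * J c b * pderiv d (fun z => g' z a c) (T y) with hK
  have hhs : ∀ i j b, h i j b = h j i b := fun i j b => by simp only [hh, hHs _ i j]
  have hdg' : ∀ i j b, pderiv i (fun z => g z j b) y = h i j b + h i b j + K i j b := by
    intro i j b
    have : h i b j = ∑ a, ∑ c, H c i b * J a j * g' (T y) a c := by
      simp only [hh]
      rw [Finset.sum_comm]
      refine Finset.sum_congr rfl fun a _ => Finset.sum_congr rfl fun c _ => ?_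
      rw [hs'.apply a c]
    rw [hdg, this]
    simp only [hh, hK, Finset.sum_add_distrib]
  set Z : Fin n → ℝ := fun f => H f i j + ∑ a, ∑ c, J a i * J c j * christoffel g' f a c (T y)
    with hZ
  -- with the upper index lowered, all but one of the `h`-terms cancel
  have key : ∀ b, ∑ a, g y b a * christoffel g a i j y =
      ∑ c, J c b * ∑ f, g' (T y) c f * Z f := by
    intro b
    have e1 : ∑ a, g y b a * christoffel g a i j y = 1 / 2 * (pderiv i (fun z => g z j b) y
        + pderiv j (fun z => g z i b) y - pderiv b (fun z => g z i j) y) :=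
      sum_mul_christoffelAlong (e := fun i => EuclideanSpace.single i 1) hd b i j
    have e2 : ∑ c, J c b * ∑ f, g' (T y) c f * H f i j = h i j b := by
      simp only [hh]
      rw [Finset.sum_comm]
      refine Finset.sum_congr rfl fun c _ => ?_
      rw [Finset.mul_sum]
      refine Finset.sum_congr rfl fun f _ => ?_
      rw [hs'.apply f c]
      ring
    have e3 : ∑ c, J c b * ∑ f, g' (T y) c f *
          ∑ a, ∑ c, J a i * J c j * christoffel g' f a c (T y) =
        1 / 2 * (K i j b + K j i b - K b i j) := by
      have l : ∀ c a a', ∑ f, g' (T y) c f * christoffel g' f a a' (T y) =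
          1 / 2 * (pderiv a (fun z => g' z a' c) (T y) + pderiv a' (fun z => g' z a c) (T y)
            - pderiv c (fun z => g' z a a') (T y)) := fun c a a' =>
        sum_mul_christoffelAlong (e := fun i => EuclideanSpace.single i 1) hd' c a a'
      have l1 : K i j b = ∑ c, ∑ a, ∑ a', J a i * J a' j * J c b *
          pderiv a (fun z => g' z a' c) (T y) := by
        simp only [hK]
        rw [Finset.sum_comm]
        refine Finset.sum_congr rfl fun c _ => ?_
        rw [Finset.sum_comm]
      have l2 : K j i b = ∑ c, ∑ a, ∑ a', J a i * J a' j * J c b *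
          pderiv a' (fun z => g' z a c) (T y) := by
        simp only [hK]
        rw [Finset.sum_comm]
        refine Finset.sum_congr rfl fun c _ => Finset.sum_congr rfl fun a _ =>
          Finset.sum_congr rfl fun d _ => ?_
        ring
      have l3 : K b i j = ∑ c, ∑ a, ∑ a', J a i * J a' j * J c b *
          pderiv c (fun z => g' z a a') (T y) := by
        simp only [hK]
        rw [Finset.sum_comm_cycle]
        refine Finset.sum_congr rfl fun c _ => Finset.sum_congr rfl fun a _ =>
          Finset.sum_congr rfl fun d _ => ?_
        ring
      rw [l1, l2, l3]
      simp only [← Finset.sum_add_distrib, ← Finset.sum_sub_distrib, Finset.mul_sum]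
      refine Finset.sum_congr rfl fun c _ => ?_
      rw [Finset.sum_comm]
      refine Finset.sum_congr rfl fun a _ => ?_
      rw [Finset.sum_comm]
      refine Finset.sum_congr rfl fun a' _ => ?_
      have := l c a a'
      calc _ = J a i * J a' j * J c b * ∑ f, g' (T y) c f * christoffel g' f a a' (T y) := by
            rw [Finset.mul_sum]
            exact Finset.sum_congr rfl fun f _ => by ring
        _ = _ := by rw [this]; ring
    rw [e1, hdg', hdg', hdg']
    simp only [hZ, mul_add, Finset.sum_add_distrib, e2]
    rw [e3, hhs j i b, hhs b i j, hhs b j i]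
    ring
  have hmv : (J.transpose * g' (T y)).mulVec (J.mulVec fun k => christoffel g k i j y) =
      (J.transpose * g' (T y)).mulVec Z := by
    rw [Matrix.mulVec_mulVec, ← hgy, ← Matrix.mulVec_mulVec]
    ext b
    simpa only [Matrix.mulVec, dotProduct, Matrix.transpose_apply] using key b
  have hinj : IsUnit (J.transpose * g' (T y)) := by
    rw [Matrix.isUnit_iff_isUnit_det, Matrix.det_mul, Matrix.det_transpose]
    exact (mul_ne_zero hdJ hd').isUnit
  exact congrFun (Matrix.mulVec_injective_of_isUnit hinj hmv) d

/-- The variation field transforms as a vector density: the inhomogeneous term in the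
transformation law of the Christoffel symbols does not depend on the parameter `t`. -/
lemma variationField_transform {G G' : ℝ × Coord n → Matrix (Fin n) (Fin n) ℝ}
    {m m' : ℝ × Coord n → ℝ} {T : Coord n → Coord n} {t : ℝ}
    {y : Coord n} (hT : ContDiffAt ℝ ∞ T y)
    (hG : ∀ᶠ s in nhds t, ∀ i j, ContDiffAt ℝ ∞ (fun q => G q i j) (s, y))
    (hG' : ∀ᶠ s in nhds t, ∀ i j, ContDiffAt ℝ ∞ (fun q => G' q i j) (s, T y))
    (hS' : ∀ᶠ s in nhds t, ∀ᶠ z in nhds (T y), (G' (s, z)).IsSymm)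
    (hd : ∀ᶠ s in nhds t, (G (s, y)).det ≠ 0)
    (hGG' : ∀ᶠ s in nhds t, ∀ᶠ z in nhds y,
      G (s, z) = (jacMatrix T z).transpose * G' (s, T z) * jacMatrix T z)
    (hm : m (t, y) = |(jacMatrix T y).det| * m' (t, T y)) (d : Fin n) :
    ∑ k, jacMatrix T y d k * variationField spatial G m (1, 0) k (t, y) =
      |(jacMatrix T y).det| * variationField spatial G' m' (1, 0) d (t, T y) := by
  set J := jacMatrix T y with hJ
  have hgy := hGG'.self_of_nhds.self_of_nhds
  have hdt := hd.self_of_nhds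
  rw [← hJ] at hgy
  have hdJ : J.det ≠ 0 := fun h => hdt (by rw [hgy, Matrix.det_mul, h, mul_zero])
  have hd' : (G' (t, T y)).det ≠ 0 := fun h =>
    hdt (by rw [hgy, Matrix.det_mul, Matrix.det_mul, h, mul_zero, zero_mul])
  have hΓ := fun k i j => contDiffAt_christoffelAlong (e := spatial) hG.self_of_nhds hdt k i j
  have hΓ' := fun k i j => contDiffAt_christoffelAlong (e := spatial) hG'.self_of_nhds hd' k i j
  have hlaw : ∀ i j, ∑ k, J d k * dirDeriv (1, 0) (christoffelAlong spatial G k i j) (t, y) =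
      ∑ a, ∑ c, J a i * J c j *
        dirDeriv (1, 0) (christoffelAlong spatial G' d a c) (t, T y) := by
    intro i j
    have e : (fun s => ∑ k, J d k * christoffelAlong spatial G k i j (s, y)) =ᶠ[nhds t]
        fun s => pderiv i (pderiv j fun z => T z d) y +
          ∑ a, ∑ c, J a i * J c j * christoffelAlong spatial G' d a c (s, T y) := by
      filter_upwards [hG, hG', hS', hd, hGG'] with s h1 h2 h3 h4 h5
      have h2' : ∀ i j, ContDiffAt ℝ ∞ (fun z => G' (s, z) i j) (T y) := fun i j =>
        ContDiffAt.comp (g := fun q => G' q i j) (T y) (h2 i j) (by fun_prop)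
      have := christoffel_transform (g := fun z => G (s, z)) (g' := fun z => G' (s, z)) hT
        h2' h3 h4 h5 d i j
      simpa only [christoffel_slice h1, christoffel_slice h2, ← hJ] using this
    have d1 : HasDerivAt (fun s => ∑ k, J d k * christoffelAlong spatial G k i j (s, y))
        (∑ k, J d k * dirDeriv (1, 0) (christoffelAlong spatial G k i j) (t, y)) t :=
      HasDerivAt.fun_sum fun k _ => (deriv_slice (hΓ k i j).diff).const_mul _
    have d2 : HasDerivAt (fun s => pderiv i (pderiv j fun z => T z d) y +
          ∑ a, ∑ c, J a i * J c j * christoffelAlong spatial G' d a c (s, T y))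
        (∑ a, ∑ c, J a i * J c j *
          dirDeriv (1, 0) (christoffelAlong spatial G' d a c) (t, T y)) t :=
      (HasDerivAt.fun_sum fun a _ => HasDerivAt.fun_sum fun c _ =>
        (deriv_slice (hΓ' d a c).diff).const_mul _).const_add _
    exact (d1.congr_of_eventuallyEq e.symm).unique d2
  have hinv : ∀ a c, ∑ i, ∑ j, (G (t, y))⁻¹ i j * (J a i * J c j) = (G' (t, T y))⁻¹ a c := by
    intro a c
    have hJu := isUnit_iff_ne_zero.2 hdJ
    have : (G' (t, T y))⁻¹ = J * (G (t, y))⁻¹ * J.transpose := by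
      rw [hgy, Matrix.mul_inv_rev, Matrix.mul_inv_rev, ← Matrix.mul_assoc,
        Matrix.mul_nonsing_inv _ hJu, one_mul, Matrix.mul_assoc,
        Matrix.nonsing_inv_mul _ (by rwa [Matrix.det_transpose]), mul_one]
    rw [this, Matrix.mul_apply, Finset.sum_comm]
    simp only [Matrix.mul_apply, Finset.sum_mul, Matrix.transpose_apply]
    exact Finset.sum_congr rfl fun i _ => Finset.sum_congr rfl fun j _ => by ring
  simp only [variationField]
  set B : Fin n → Fin n → Fin n → ℝ :=
    fun k i j => dirDeriv (1, 0) (christoffelAlong spatial G k i j) (t, y) with hB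
  set B' : Fin n → Fin n → ℝ :=
    fun a c => dirDeriv (1, 0) (christoffelAlong spatial G' d a c) (t, T y) with hB'
  calc ∑ k, J d k * (m (t, y) * ∑ i, ∑ j, (G (t, y))⁻¹ i j * B k i j)
      = m (t, y) * ∑ i, ∑ j, (G (t, y))⁻¹ i j * ∑ k, J d k * B k i j := by
        simp only [Finset.mul_sum]
        rw [← Finset.sum_comm_cycle]
        exact Finset.sum_congr rfl fun k _ => Finset.sum_congr rfl fun i _ =>
          Finset.sum_congr rfl fun j _ => by ring
    _ = m (t, y) * ∑ i, ∑ j, (G (t, y))⁻¹ i j * ∑ a, ∑ c, J a i * J c j * B' a c := by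
        simp only [hB, hlaw]
        rfl
    _ = m (t, y) * ∑ a, ∑ c, (∑ i, ∑ j, (G (t, y))⁻¹ i j * (J a i * J c j)) * B' a c := by
        congr 1
        simp only [Finset.mul_sum, Finset.sum_mul]
        rw [Finset.sum_comm_cycle]
        refine Finset.sum_congr rfl fun a _ => ?_
        rw [Finset.sum_comm_cycle]
        exact Finset.sum_congr rfl fun c _ => Finset.sum_congr rfl fun i _ =>
          Finset.sum_congr rfl fun j _ => by ring
    _ = _ := by
        simp only [hinv]
        rw [hm, mul_assoc]

end ChangeOfCoordinates

/-! ### The divergence theorem -/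

section Divergence

open MeasureTheory

variable {n : ℕ} {M : Type*} [TopologicalSpace M] [ChartedSpace (Coord n) M]
  [IsManifold (𝓡 n) ∞ M]

lemma contDiffAt_transition (φ ψ : Chart n M) {y : Coord n} (hy : y ∈ φ.1.target)
    (hy' : φ.1.symm y ∈ ψ.1.source) :
    ContDiffAt ℝ ∞ (fun z => ψ.1 (φ.1.symm z)) y := by
  have h1 : ContMDiffAt (𝓡 n) (𝓡 n) ∞ (fun z => ψ.1 (φ.1.symm z)) y :=
    ContMDiffAt.comp y
      ((contMDiffOn_of_mem_maximalAtlas (IsManifold.subset_maximalAtlas ψ.2)).contMDiffAt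
        (ψ.1.open_source.mem_nhds hy'))
      ((contMDiffOn_symm_of_mem_maximalAtlas (IsManifold.subset_maximalAtlas φ.2)).contMDiffAt
        (φ.1.open_target.mem_nhds hy))
  exact contMDiffAt_iff_contDiffAt.1 h1

/-- The integral of a density supported in the domains of two charts can be computed in either. -/
lemma integral_change_chart {f : Chart n M → Coord n → ℝ} (φ ψ : Chart n M)
    (hf : ∀ x ∈ φ.1.source ∩ ψ.1.source,
      f φ (φ.1 x) = |(jacobian φ ψ (φ.1 x)).det| * f ψ (ψ.1 x))
    (hφ : ∀ y ∈ φ.1.target, φ.1.symm y ∉ ψ.1.source → f φ y = 0)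
    (hψ : ∀ y ∈ ψ.1.target, ψ.1.symm y ∉ φ.1.source → f ψ y = 0) :
    ∫ y in φ.1.target, f φ y = ∫ y in ψ.1.target, f ψ y := by
  set e : OpenPartialHomeomorph (Coord n) (Coord n) := φ.1.symm.trans ψ.1 with he
  have hs : e.source = φ.1.target ∩ φ.1.symm ⁻¹' ψ.1.source := by simp [he]
  have ht : e.target = ψ.1.target ∩ ψ.1.symm ⁻¹' φ.1.source := by simp [he]
  have h1 : ∫ y in φ.1.target, f φ y = ∫ y in e.source, f φ y := by
    refine setIntegral_eq_of_subset_of_forall_sdiff_eq_zero φ.1.open_target.measurableSet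
      (by rw [hs]; exact Set.inter_subset_left) fun y hy => hφ y hy.1 fun h => hy.2 ?_
    rw [hs]
    exact ⟨hy.1, h⟩
  have h2 : ∫ y in ψ.1.target, f ψ y = ∫ y in e.target, f ψ y := by
    refine setIntegral_eq_of_subset_of_forall_sdiff_eq_zero ψ.1.open_target.measurableSet
      (by rw [ht]; exact Set.inter_subset_left) fun y hy => hψ y hy.1 fun h => hy.2 ?_
    rw [ht]
    exact ⟨hy.1, h⟩
  have hd : ∀ y ∈ e.source, HasFDerivAt e (fderiv ℝ e y) y := by
    intro y hy
    rw [hs] at hy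
    exact ((contDiffAt_transition φ ψ hy.1 hy.2).differentiableAt (by simp)).hasFDerivAt
  rw [h1, h2, integral_target_eq_integral_abs_det_fderiv_smul volume hd]
  refine setIntegral_congr_fun e.open_source.measurableSet fun y hy => ?_
  have hdet : (fderiv ℝ e y).det = (jacobian φ ψ y).det := by
    rw [ContinuousLinearMap.det,
      ← LinearMap.det_toMatrix (EuclideanSpace.basisFun (Fin n) ℝ).toBasis]
    congr 1
    ext i j
    have h3 : HasFDerivAt (fun z => ψ.1 (φ.1.symm z) i)
        ((EuclideanSpace.proj i : Coord n →L[ℝ] ℝ).comp (fderiv ℝ e y)) y :=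
      (EuclideanSpace.proj i : Coord n →L[ℝ] ℝ).hasFDerivAt.comp y (hd y hy)
    simp [LinearMap.toMatrix_apply, jacobian, pderiv, h3.fderiv]
  rw [hs] at hy
  have h4 := hf (φ.1.symm y) ⟨φ.1.map_target hy.1, hy.2⟩
  rw [φ.1.right_inv hy.1] at h4
  simp only [h4, hdet, smul_eq_mul]
  rfl

variable [T2Space M] [CompactSpace M]

variable (n) in
/-- The preferred chart at the point `x`. -/
abbrev centered (x : M) : Chart n M := ⟨chartAt (Coord n) x, chart_mem_atlas (Coord n) x⟩

/-- The function `ρₓ` of the partition of unity in the chart `φ`. -/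
def localBump (φ : Chart n M) (x : M) (y : Coord n) : ℝ := partition n M x (φ.1.symm y)

variable (n M) in
lemma finite_support_partition : {x : M | (Function.support (partition n M x)).Nonempty}.Finite :=
  (partition n M).locallyFinite.finite_nonempty_of_compact

variable (n M) in
/-- The finitely many indices of the nonzero functions of the partition of unity. -/
def bumpIndices : Finset M := (finite_support_partition n M).toFinset

lemma partition_eq_zero {x : M} (hx : x ∉ bumpIndices n M) (z : M) : partition n M x z = 0 := by
  by_contra h
  exact hx ((finite_support_partition n M).mem_toFinset.2 ⟨z, h⟩)

lemma sum_partition (z : M) : ∑ x ∈ bumpIndices n M, partition n M x z = 1 := by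
  rw [← (partition n M).sum_eq_one (Set.mem_univ z)]
  refine (finsum_eq_sum_of_support_subset _ fun x hx => ?_).symm
  by_contra h
  exact hx (partition_eq_zero h z)

lemma integralDensity_eq_sum (f : Chart n M → Coord n → ℝ) :
    integralDensity f = ∑ x ∈ bumpIndices n M, ∫ y in (centered n x).1.target,
      localBump (centered n x) x y * f (centered n x) y := by
  refine finsum_eq_sum_of_support_subset _ fun x hx => ?_
  by_contra h
  refine hx ?_
  simp [partition_eq_zero (n := n) h]

lemma tsupport_partition_subset (x : M) : tsupport (partition n M x) ⊆ (centered n x).1.source :=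
  (exists_partition n M).choose_spec x

lemma contDiffAt_localBump (φ : Chart n M) (x : M) {y : Coord n} (hy : y ∈ φ.1.target) :
    ContDiffAt ℝ ∞ (localBump φ x) y := by
  have h1 : ContMDiffOn (𝓡 n) 𝓘(ℝ, ℝ) ∞ (localBump φ x) φ.1.target :=
    (partition n M x).contMDiff.comp_contMDiffOn
      (contMDiffOn_symm_of_mem_maximalAtlas (IsManifold.subset_maximalAtlas φ.2))
  exact (contMDiffOn_iff_contDiffOn.1 h1).contDiffAt (φ.1.open_target.mem_nhds hy)

lemma localBump_eventuallyEq_zero (φ : Chart n M) (x : M) {y : Coord n} (hy : y ∈ φ.1.target)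
    (h : φ.1.symm y ∉ tsupport (partition n M x)) : localBump φ x =ᶠ[nhds y] fun _ => 0 :=
  (φ.1.continuousAt_symm hy).eventually (notMem_tsupport_iff_eventuallyEq.1 h)

variable (n) in
/-- The support of `ρₓ` in the preferred chart at `x`. -/
def bumpSupport (x : M) : Set (Coord n) := (centered n x).1 '' tsupport (partition n M x)

lemma isCompact_bumpSupport (x : M) : IsCompact (bumpSupport n x) :=
  (isClosed_tsupport _).isCompact.image_of_continuousOn
    ((centered n x).1.continuousOn.mono (tsupport_partition_subset x))

lemma bumpSupport_subset (x : M) : bumpSupport n x ⊆ (centered n x).1.target := by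
  rintro _ ⟨z, hz, rfl⟩
  exact (centered n x).1.map_source (tsupport_partition_subset x hz)

lemma symm_notMem_tsupport {x : M} {y : Coord n} (hy : y ∈ (centered n x).1.target)
    (h : y ∉ bumpSupport n x) : (centered n x).1.symm y ∉ tsupport (partition n M x) :=
  fun h' => h ⟨_, h', (centered n x).1.right_inv hy⟩

variable (n) in
/-- The function `ρₓ` in the preferred chart at `x`, extended by zero to the coordinate space. -/
def bump (x : M) : Coord n → ℝ := (centered n x).1.target.indicator (localBump (centered n x) x)

lemma bump_eventuallyEq (x : M) {y : Coord n} (hy : y ∈ (centered n x).1.target) :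
    bump n x =ᶠ[nhds y] localBump (centered n x) x :=
  Filter.mem_of_superset ((centered n x).1.open_target.mem_nhds hy) fun _ hz =>
    Set.indicator_of_mem hz _

lemma bump_eq (x : M) {y : Coord n} (hy : y ∈ (centered n x).1.target) :
    bump n x y = localBump (centered n x) x y := (bump_eventuallyEq x hy).self_of_nhds

lemma support_bump_subset (x : M) : Function.support (bump n x) ⊆ bumpSupport n x := by
  intro y hy
  have hy' : y ∈ (centered n x).1.target := Set.mem_of_indicator_ne_zero hy
  by_contra h
  refine hy ?_
  rw [bump_eq x hy']
  exact (localBump_eventuallyEq_zero _ _ hy' (symm_notMem_tsupport hy' h)).self_of_nhds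

lemma tsupport_bump_subset (x : M) : tsupport (bump n x) ⊆ bumpSupport n x :=
  closure_minimal (support_bump_subset x) (isCompact_bumpSupport x).isClosed

lemma contDiff_bump (x : M) : ContDiff ℝ ∞ (bump n x) := by
  rw [contDiff_iff_contDiffAt]
  intro y
  by_cases hy : y ∈ (centered n x).1.target
  · exact (contDiffAt_localBump _ x hy).congr_of_eventuallyEq (bump_eventuallyEq x hy)
  · have : y ∉ tsupport (bump n x) := fun h => hy (bumpSupport_subset x (tsupport_bump_subset x h))
    exact contDiffAt_const.congr_of_eventuallyEq (notMem_tsupport_iff_eventuallyEq.1 this)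

/-- A function continuous on an open set and vanishing off a compact subset is integrable there. -/
lemma integrableOn_of_compact {U K : Set (Coord n)} (hU : IsOpen U) (hK : IsCompact K)
    (hKU : K ⊆ U) {f : Coord n → ℝ} (hf : ContinuousOn f U) (h0 : ∀ y ∈ U, y ∉ K → f y = 0) :
    IntegrableOn f U :=
  IntegrableOn.of_forall_sdiff_eq_zero ((hf.mono hKU).integrableOn_compact hK) hU.measurableSet
    fun y hy => h0 y hy.1 hy.2

lemma continuousOn_pderiv {U : Set (Coord n)} {f : Coord n → ℝ}
    (hf : ∀ y ∈ U, ContDiffAt ℝ ∞ f y) (k : Fin n) : ContinuousOn (pderiv k f) U :=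
  fun y hy => (contDiffAt_dirDeriv (EuclideanSpace.single k (1 : ℝ))
    (hf y hy)).continuousAt.continuousWithinAt

lemma pderiv_localBump_eq_zero (φ : Chart n M) (x : M) {y : Coord n} (hy : y ∈ φ.1.target)
    (h : φ.1.symm y ∉ tsupport (partition n M x)) (k : Fin n) :
    pderiv k (localBump φ x) y = 0 :=
  (dirDeriv_congr _ (localBump_eventuallyEq_zero φ x hy h)).trans (dirDeriv_const _ 0 y)

/-- Integration by parts against `ρₓ` in the preferred chart at `x`. -/
lemma integral_localBump_mul_pderiv (x : M) {f : Coord n → ℝ}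
    (hf : ∀ y ∈ (centered n x).1.target, ContDiffAt ℝ ∞ f y) (k : Fin n) :
    ∫ y in (centered n x).1.target, localBump (centered n x) x y * pderiv k f y =
      -∫ y in (centered n x).1.target, pderiv k (localBump (centered n x) x) y * f y := by
  set U := (centered n x).1.target with hU
  have hUo : IsOpen U := (centered n x).1.open_target
  set r := bump n x with hr
  have hts : ∀ y ∉ bumpSupport n x, y ∉ tsupport r := fun y hy h => hy (tsupport_bump_subset x h)
  have hr0 : ∀ y ∉ bumpSupport n x, r y = 0 := fun y hy => by
    by_contra h
    exact hy (support_bump_subset x h)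
  have hr1 : ∀ y ∉ bumpSupport n x, pderiv k r y = 0 := fun y hy =>
    (dirDeriv_congr _ (notMem_tsupport_iff_eventuallyEq.1 (hts y hy))).trans
      (dirDeriv_const _ 0 y)
  have hrs : ∀ y ∈ U, ContDiffAt ℝ ∞ r y := fun y _ => (contDiff_bump x).contDiffAt
  have hfc : ContinuousOn f U := fun y hy => (hf y hy).continuousAt.continuousWithinAt
  have hrc : ContinuousOn r U := (contDiff_bump x).continuous.continuousOn
  have int : ∀ F : Coord n → ℝ, ContinuousOn F U → (∀ y ∉ bumpSupport n x, F y = 0) →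
      Integrable F := fun F hF h0 => by
    rw [← integrableOn_iff_integrable_of_support_subset (s := U)]
    · exact integrableOn_of_compact hUo (isCompact_bumpSupport x) (bumpSupport_subset x) hF
        fun y _ hy => h0 y hy
    · intro y hy
      by_contra h
      exact hy (h0 y fun h' => h (bumpSupport_subset x h'))
  have key := integral_mul_fderiv_eq_neg_fderiv_mul_of_integrable (μ := volume) (f := r) (g := f)
    (v := EuclideanSpace.single k (1 : ℝ))
    (int _ ((continuousOn_pderiv hrs k).mul hfc) fun y hy => by
      simp [show fderiv ℝ r y (EuclideanSpace.single k 1) = 0 from hr1 y hy])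
    (int _ (hrc.mul (continuousOn_pderiv hf k)) fun y hy => by simp [hr0 y hy])
    (int _ (hrc.mul hfc) fun y hy => by simp [hr0 y hy])
    (fun y _ => (contDiff_bump x).differentiable (by simp) y)
    (fun y hy => (hf y (bumpSupport_subset x (tsupport_bump_subset x hy))).diff)
  have c1 : ∫ y in U, localBump (centered n x) x y * pderiv k f y =
      ∫ y, r y * pderiv k f y := by
    rw [← setIntegral_eq_integral_of_forall_compl_eq_zero (s := U) (f := fun y => r y * _)]
    · exact setIntegral_congr_fun hUo.measurableSet fun y hy => by simp only [hr, bump_eq x hy]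
    · intro y hy
      rw [hr0 y fun h => hy (bumpSupport_subset x h), zero_mul]
  have c2 : ∫ y in U, pderiv k (localBump (centered n x) x) y * f y =
      ∫ y, pderiv k r y * f y := by
    rw [← setIntegral_eq_integral_of_forall_compl_eq_zero (s := U)
      (f := fun y => pderiv k r y * f y)]
    · refine setIntegral_congr_fun hUo.measurableSet fun y hy => ?_
      congr 1
      exact (dirDeriv_congr _ (bump_eventuallyEq x hy)).symm
    · intro y hy
      rw [hr1 y fun h => hy (bumpSupport_subset x h), zero_mul]
  rw [c1, c2]
  exact key

/-- The divergence theorem on a closed manifold, for a smooth vector density `X`. The invariance of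
the divergence under a change of charts is not needed: integration by parts in each chart comes
first, and only the density `⟨X, dρₓ⟩` is then moved between charts. -/
theorem integralDensity_divergence {X : Chart n M → Fin n → Coord n → ℝ}
    (hX : ∀ φ k, ∀ y ∈ φ.1.target, ContDiffAt ℝ ∞ (X φ k) y)
    (htr : ∀ φ ψ : Chart n M, ∀ z ∈ φ.1.source ∩ ψ.1.source, ∀ d,
      ∑ k, jacobian φ ψ (φ.1 z) d k * X φ k (φ.1 z) =
        |(jacobian φ ψ (φ.1 z)).det| * X ψ d (ψ.1 z)) :
    integralDensity (fun φ y => ∑ k, pderiv k (X φ k) y) = 0 := by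
  -- `D x` is the density `⟨X, dρₓ⟩`
  set D : M → Chart n M → Coord n → ℝ := fun x φ y =>
    ∑ k, pderiv k (localBump φ x) y * X φ k y with hD
  set S := bumpIndices n M
  have hXc : ∀ φ k, ContinuousOn (X φ k) φ.1.target := fun φ k y hy =>
    (hX φ k y hy).continuousAt.continuousWithinAt
  have hbc : ∀ (φ : Chart n M) x, ContinuousOn (localBump φ x) φ.1.target := fun φ x y hy =>
    (contDiffAt_localBump φ x hy).continuousAt.continuousWithinAt
  have hbd : ∀ (φ : Chart n M) x k, ContinuousOn (pderiv k (localBump φ x)) φ.1.target :=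
    fun φ x k => continuousOn_pderiv (fun y hy => contDiffAt_localBump φ x hy) k
  have hDc : ∀ x φ, ContinuousOn (D x φ) φ.1.target := fun x φ =>
    continuousOn_finsetSum _ fun k _ => (hbd φ x k).mul (hXc φ k)
  have hD0 : ∀ x φ, ∀ y ∈ φ.1.target, φ.1.symm y ∉ tsupport (partition n M x) → D x φ y = 0 := by
    intro x φ y hy h
    simp only [hD, pderiv_localBump_eq_zero φ x hy h, zero_mul, Finset.sum_const_zero]
  have hb0 : ∀ x (φ : Chart n M), ∀ y ∈ φ.1.target, φ.1.symm y ∉ tsupport (partition n M x) →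
      localBump φ x y = 0 := fun x φ y hy h =>
    (localBump_eventuallyEq_zero φ x hy h).self_of_nhds
  have hK : ∀ x, ∀ y ∈ (centered n x).1.target, y ∉ bumpSupport n x →
      (centered n x).1.symm y ∉ tsupport (partition n M x) := fun x y hy h =>
    symm_notMem_tsupport hy h
  have hint : ∀ x {F : Coord n → ℝ}, ContinuousOn F (centered n x).1.target →
      (∀ y ∈ (centered n x).1.target,
        (centered n x).1.symm y ∉ tsupport (partition n M x) → F y = 0) →
      IntegrableOn F (centered n x).1.target := fun x F hF h0 =>
    integrableOn_of_compact (centered n x).1.open_target (isCompact_bumpSupport x)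
      (bumpSupport_subset x) hF fun y hy h => h0 y hy (hK x y hy h)
  have hDtr : ∀ x (φ ψ : Chart n M), ∀ z ∈ φ.1.source ∩ ψ.1.source,
      D x φ (φ.1 z) = |(jacobian φ ψ (φ.1 z)).det| * D x ψ (ψ.1 z) := by
    intro x φ ψ z hz
    have hy : φ.1 z ∈ φ.1.target := φ.1.map_source hz.1
    have hy' : φ.1.symm (φ.1 z) ∈ ψ.1.source := by rw [φ.1.left_inv hz.1]; exact hz.2
    have e1 : ∀ k, pderiv k (localBump φ x) (φ.1 z) =
        ∑ c, jacobian φ ψ (φ.1 z) c k * pderiv c (localBump ψ x) (ψ.1 z) := by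
      intro k
      have hT := contDiffAt_transition φ ψ hy hy'
      have e2 : localBump φ x =ᶠ[nhds (φ.1 z)]
          fun w => localBump ψ x (ψ.1 (φ.1.symm w)) := by
        have : ∀ᶠ w in nhds (φ.1 z), φ.1.symm w ∈ ψ.1.source :=
          (φ.1.continuousAt_symm hy).eventually (ψ.1.open_source.mem_nhds hy')
        filter_upwards [this] with w hw
        simp only [localBump, ψ.1.left_inv hw]
      have e3 := pderiv_comp (f := localBump ψ x) hT
        (contDiffAt_localBump ψ x (ψ.1.map_source hy')).diff k
      rw [φ.1.left_inv hz.1] at e3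
      exact (dirDeriv_congr _ e2).trans e3
    simp only [hD, e1, Finset.sum_mul, Finset.mul_sum]
    rw [Finset.sum_comm]
    refine Finset.sum_congr rfl fun c _ => ?_
    rw [mul_left_comm, ← htr φ ψ z hz c, Finset.mul_sum]
    exact Finset.sum_congr rfl fun k _ => by ring
  -- the differentials of the partition of unity sum to zero
  have hDsum : ∀ φ : Chart n M, ∀ y ∈ φ.1.target, ∑ x ∈ S, D x φ y = 0 := by
    intro φ y hy
    have e1 : ∀ k, ∑ x ∈ S, pderiv k (localBump φ x) y = 0 := by
      intro k
      have e2 := dirDeriv_sum (EuclideanSpace.single k (1 : ℝ)) (s := S) (f := localBump φ)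
        (p := y) fun x _ => (contDiffAt_localBump φ x hy).diff
      have e3 : (fun q => ∑ x ∈ S, localBump φ x q) = fun _ => 1 :=
        funext fun q => sum_partition _
      rw [e3, dirDeriv_const] at e2
      exact e2.symm
    simp only [hD]
    rw [Finset.sum_comm]
    simp only [← Finset.sum_mul, e1, zero_mul, Finset.sum_const_zero]
  have step1 : ∀ x, ∫ y in (centered n x).1.target, localBump (centered n x) x y *
      ∑ k, pderiv k (X (centered n x) k) y = -∫ y in (centered n x).1.target,
        D x (centered n x) y := by
    intro x
    simp only [hD, Finset.mul_sum]
    rw [integral_finsetSum, integral_finsetSum, ← Finset.sum_neg_distrib]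
    · exact Finset.sum_congr rfl fun k _ => integral_localBump_mul_pderiv x (hX _ k) k
    · intro k _
      exact hint x ((hbd _ x k).mul (hXc _ k)) fun y hy h => by
        rw [pderiv_localBump_eq_zero _ x hy h, zero_mul]
    · intro k _
      exact hint x ((hbc _ x).mul (continuousOn_pderiv (hX _ k) k)) fun y hy h => by
        rw [hb0 x _ y hy h, zero_mul]
  -- insert `∑ ρₓ' = 1` and pass from the chart at `x` to the chart at `x'`
  have step2 : ∀ x, ∫ y in (centered n x).1.target, D x (centered n x) y =
      ∑ x' ∈ S, ∫ y in (centered n x').1.target,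
        localBump (centered n x') x' y * D x (centered n x') y := by
    intro x
    have e1 : ∫ y in (centered n x).1.target, D x (centered n x) y =
        ∑ x' ∈ S, ∫ y in (centered n x).1.target,
          localBump (centered n x) x' y * D x (centered n x) y := by
      rw [← integral_finsetSum]
      · refine integral_congr_ae (Filter.Eventually.of_forall fun y => ?_)
        change _ = ∑ x' ∈ S, localBump (centered n x) x' y * D x (centered n x) y
        rw [← Finset.sum_mul]
        have : ∑ x' ∈ S, localBump (centered n x) x' y = 1 := sum_partition _
        rw [this, one_mul]
      · intro x' _
        exact hint x ((hbc _ x').mul (hDc x _)) fun y hy h => by rw [hD0 x _ y hy h, mul_zero]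
    rw [e1]
    refine Finset.sum_congr rfl fun x' _ => ?_
    refine integral_change_chart (f := fun φ y => localBump φ x' y * D x φ y) (centered n x)
      (centered n x') (fun z hz => ?_) (fun y hy h => ?_) (fun y hy h => ?_)
    · have e2 : ∀ φ : Chart n M, z ∈ φ.1.source → localBump φ x' (φ.1 z) = partition n M x' z :=
        fun φ hφ => by rw [localBump, φ.1.left_inv hφ]
      change localBump _ x' _ * _ = _ * (localBump _ x' _ * _)
      rw [e2 _ hz.1, e2 _ hz.2, hDtr x _ _ z hz]
      ring
    · rw [hb0 x' _ y hy fun h' => h (tsupport_partition_subset x' h'), zero_mul]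
    · rw [hD0 x _ y hy fun h' => h (tsupport_partition_subset x h'), mul_zero]
  rw [integralDensity_eq_sum]
  simp only [step1, step2, Finset.sum_neg_distrib]
  rw [neg_eq_zero, Finset.sum_comm]
  refine Finset.sum_eq_zero fun x' _ => ?_
  rw [← integral_finsetSum]
  · simp only [← Finset.mul_sum]
    rw [setIntegral_congr_fun (g := fun _ => (0 : ℝ)) (centered n x').1.open_target.measurableSet
      fun y hy => mul_eq_zero_of_right _ (hDsum _ y hy)]
    simp
  · intro x _
    exact hint x' ((hbc _ x').mul (hDc x _)) fun y hy h => by rw [hb0 x' _ y hy h, zero_mul]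

end Divergence

/-! ### The pairing and the family of metrics -/

section Pairing

variable {n : ℕ}

lemma pairing_self_left {A : Matrix (Fin n) (Fin n) ℝ} (hA : A.IsSymm) (hd : A.det ≠ 0)
    (R : Matrix (Fin n) (Fin n) ℝ) : pairing A A R = ∑ i, ∑ j, A⁻¹ i j * R i j := by
  have hu : IsUnit A.det := isUnit_iff_ne_zero.2 hd
  rw [← sum_inv_mul_mul_inv_mul hA]
  refine Finset.sum_congr rfl fun i _ => Finset.sum_congr rfl fun j _ => ?_
  congr 1
  have h : (A⁻¹ * A * A⁻¹) i j = A⁻¹ i j := by rw [Matrix.nonsing_inv_mul _ hu, one_mul]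
  rw [← h, Matrix.mul_apply, Finset.sum_comm]
  simp only [Matrix.mul_apply, Finset.sum_mul]

lemma pairing_comm {A : Matrix (Fin n) (Fin n) ℝ} (hA : A.IsSymm)
    (S T : Matrix (Fin n) (Fin n) ℝ) : pairing A S T = pairing A T S := by
  have hs : A⁻¹.IsSymm := by rw [Matrix.IsSymm, Matrix.transpose_nonsing_inv, hA.eq]
  have h : ∀ i j k l, A⁻¹ i k * A⁻¹ j l * S i j * T k l =
      A⁻¹ k i * A⁻¹ l j * T k l * S i j := fun i j k l => by
    rw [hs.apply k i, hs.apply l j]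
    ring
  simp only [pairing, h]
  rw [Finset.sum_comm_cycle]
  exact Finset.sum_congr rfl fun a _ => Finset.sum_comm_cycle

lemma pairing_add_left (A S S' T : Matrix (Fin n) (Fin n) ℝ) :
    pairing A (S + S') T = pairing A S T + pairing A S' T := by
  simp only [pairing, Matrix.add_apply, mul_add, add_mul, Finset.sum_add_distrib]

lemma pairing_smul_left (A S T : Matrix (Fin n) (Fin n) ℝ) (r : ℝ) :
    pairing A (r • S) T = r * pairing A S T := by
  simp only [pairing, Matrix.smul_apply, smul_eq_mul, Finset.mul_sum]
  refine Finset.sum_congr rfl fun i _ => Finset.sum_congr rfl fun j _ =>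
    Finset.sum_congr rfl fun k _ => Finset.sum_congr rfl fun l _ => ?_
  ring

lemma inv_smul_of_ne_zero {L : Matrix (Fin n) (Fin n) ℝ} {r : ℝ} (hr : r ≠ 0) (hd : L.det ≠ 0) :
    (r • L)⁻¹ = r⁻¹ • L⁻¹ := by
  have h := Matrix.inv_smul' L (Units.mk0 r hr) (isUnit_iff_ne_zero.2 hd)
  rw [Units.smul_def, Units.smul_def, Units.val_inv_eq_inv_val] at h
  exact h

/-- The first variation of the metric `g = a b L`, paired with the Ricci tensor `R`. Here `L` is the
segment `c₀ + t v` with velocity `V = v`, the factor `a` is `m^(2/n)`, and `b` is the normalizing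
factor `det(L)^(-1/n)`, whose derivative accounts for the trace term. Only the trace-free
part `-R + (1/n) s g` of `-R` matters, where `s` is the trace of `R`, and the powers of the volume
coefficient `m` combine to a density. -/
lemma pairing_variation {L V R : Matrix (Fin n) (Fin n) ℝ} (hL : L.IsSymm) (hV : V.IsSymm)
    (hd : L.det ≠ 0) {a b m m' : ℝ} (ha : a ≠ 0) (hb : b ≠ 0)
    (hm : a * m' = m) :
    -(pairing (a • (b • L)) ((a * b) • V +
        (-(1 / (n : ℝ)) * ∑ i, ∑ j, L⁻¹ i j * V j i) • (a • (b • L))) R * m) =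
      pairing (b • L) V ((b * m') • (-R + (1 / (n : ℝ) *
        ∑ i, ∑ j, (a • (b • L))⁻¹ i j * R i j) • (a • (b • L)))) := by
  set A := a • (b • L) with hA
  have hAs : A.IsSymm := (hL.smul b).smul a
  have hab : a * b ≠ 0 := mul_ne_zero ha hb
  have hA' : A = (a * b) • L := smul_smul a b L
  have hdA : A.det ≠ 0 := by
    rw [hA', Matrix.det_smul]
    exact mul_ne_zero (pow_ne_zero _ hab) hd
  have hLi : ∀ i j, L⁻¹ i j = a * b * A⁻¹ i j := by
    intro i j
    rw [hA', inv_smul_of_ne_zero hab hd]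
    simp only [Matrix.smul_apply, smul_eq_mul]
    field_simp
  have hLb : ∀ i j, (b • L)⁻¹ i j = a * A⁻¹ i j := by
    intro i j
    rw [inv_smul_of_ne_zero hb hd, Matrix.smul_apply, hLi]
    simp only [smul_eq_mul]
    field_simp
  have hscale : ∀ S T, pairing (b • L) S T = a ^ 2 * pairing A S T := by
    intro S T
    simp only [pairing, hLb, Finset.mul_sum]
    refine Finset.sum_congr rfl fun i _ => Finset.sum_congr rfl fun j _ =>
      Finset.sum_congr rfl fun k _ => Finset.sum_congr rfl fun l _ => ?_
    ring
  have htau : ∑ i, ∑ j, L⁻¹ i j * V j i = a * b * pairing A A V := by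
    rw [pairing_self_left hAs hdA]
    simp only [hLi, Finset.mul_sum]
    refine Finset.sum_congr rfl fun i _ => Finset.sum_congr rfl fun j _ => ?_
    rw [hV.apply i j]
    ring
  have hs := pairing_self_left hAs hdA R
  clear_value A
  rw [← hs, htau, hscale, pairing_comm hAs V, pairing_smul_left, pairing_add_left,
    pairing_smul_left, pairing_add_left, pairing_smul_left, pairing_smul_left, ← hm,
    pairing_comm hAs V R, ← neg_one_smul ℝ R, pairing_smul_left]
  ring

end Pairing

section Family

variable {n : ℕ} {M : Type*} [TopologicalSpace M] [ChartedSpace (Coord n) M]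
variable (c₀ : ConformalClass n M) (v : WeightedTensor n M (-2 / (n : ℝ))) (Ω : PosDensity n M)

/-- The segment `c₀ + t v` in the chart `φ`, as a matrix field on `ℝ × ℝⁿ`. -/
def lineFamily (φ : Chart n M) (p : ℝ × Coord n) : Matrix (Fin n) (Fin n) ℝ :=
  c₀.coeff φ p.2 + p.1 • v.coeff φ p.2

/-- The metrics `g_t = Ω^(2/n) c_t` in the chart `φ`, as a matrix field on `ℝ × ℝⁿ`. -/
def metricFamily (φ : Chart n M) (p : ℝ × Coord n) : Matrix (Fin n) (Fin n) ℝ :=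
  Ω.coeff φ p.2 ^ (2 / (n : ℝ)) •
    ((lineFamily c₀ v φ p).det ^ (-1 / (n : ℝ)) • lineFamily c₀ v φ p)

/-- The coefficient of `Ω` in the chart `φ`, as a function on `ℝ × ℝⁿ`. -/
def volFamily (φ : Chart n M) (p : ℝ × Coord n) : ℝ := Ω.coeff φ p.2

/-- The set of all `(t, y)` at which `c₀ + t v` has positive determinant: an open set containing
`[0, 1] × φ.target` on which `metricFamily` is smooth. -/
def familyDomain (φ : Chart n M) : Set (ℝ × Coord n) :=
  {p | p.2 ∈ φ.1.target ∧ 0 < (lineFamily c₀ v φ p).det}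

variable {c₀ v Ω} {φ : Chart n M} {p : ℝ × Coord n}

lemma contDiffAt_lineFamily (hp : p.2 ∈ φ.1.target) (i j : Fin n) :
    ContDiffAt ℝ ∞ (fun q => lineFamily c₀ v φ q i j) p := by
  have hU := φ.1.open_target.mem_nhds hp
  have h1 : ContDiffAt ℝ ∞ (fun q : ℝ × Coord n => c₀.coeff φ q.2 i j) p :=
    ((c₀.smooth φ i j).contDiffAt hU).comp p contDiffAt_snd
  have h2 : ContDiffAt ℝ ∞ (fun q : ℝ × Coord n => v.coeff φ q.2 i j) p :=
    ((v.smooth φ i j).contDiffAt hU).comp p contDiffAt_snd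
  exact h1.add (contDiffAt_fst.mul h2)

lemma contDiffAt_volFamily (hp : p.2 ∈ φ.1.target) : ContDiffAt ℝ ∞ (volFamily Ω φ) p :=
  ((Ω.smooth φ).contDiffAt (φ.1.open_target.mem_nhds hp)).comp p contDiffAt_snd

lemma isOpen_familyDomain (φ : Chart n M) : IsOpen (familyDomain c₀ v φ) := by
  rw [isOpen_iff_mem_nhds]
  intro p hp
  have h1 : ∀ᶠ q : ℝ × Coord n in nhds p, q.2 ∈ φ.1.target :=
    continuousAt_snd.eventually (φ.1.open_target.mem_nhds hp.1)
  have h2 := (contDiffAt_det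
    (contDiffAt_lineFamily (c₀ := c₀) (v := v) hp.1)).continuousAt.eventually (lt_mem_nhds hp.2)
  filter_upwards [h1, h2] with q hq hq'
  exact ⟨hq, hq'⟩

lemma contDiffAt_metricFamily (hp : p ∈ familyDomain c₀ v φ) (i j : Fin n) :
    ContDiffAt ℝ ∞ (fun q => metricFamily c₀ v Ω φ q i j) p := by
  have h1 : ContDiffAt ℝ ∞ (fun q => volFamily Ω φ q ^ (2 / (n : ℝ))) p :=
    (contDiffAt_volFamily hp.1).rpow_const_of_ne (Ω.pos φ _ hp.1).ne'
  have h2 : ContDiffAt ℝ ∞ (fun q => (lineFamily c₀ v φ q).det ^ (-1 / (n : ℝ))) p :=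
    (contDiffAt_det (contDiffAt_lineFamily hp.1)).rpow_const_of_ne hp.2.ne'
  exact h1.mul (h2.mul (contDiffAt_lineFamily hp.1 i j))

lemma isSymm_lineFamily (hp : p.2 ∈ φ.1.target) : (lineFamily c₀ v φ p).IsSymm :=
  (c₀.symmetric φ _ hp).add ((v.symmetric φ _ hp).smul _)

lemma isSymm_metricFamily (hp : p.2 ∈ φ.1.target) : (metricFamily c₀ v Ω φ p).IsSymm :=
  ((isSymm_lineFamily hp).smul _).smul _

lemma det_metricFamily [NeZero n] (hp : p ∈ familyDomain c₀ v φ) :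
    (metricFamily c₀ v Ω φ p).det = volFamily Ω φ p ^ 2 := by
  have hn : (n : ℝ) ≠ 0 := NeZero.ne _
  have hΩ := Ω.pos φ _ hp.1
  rw [metricFamily, Matrix.det_smul, Matrix.det_smul, Fintype.card_fin,
    ← Real.rpow_mul_natCast hΩ.le, ← Real.rpow_mul_natCast hp.2.le, div_mul_cancel₀ _ hn,
    div_mul_cancel₀ _ hn, Real.rpow_neg_one, inv_mul_cancel₀ hp.2.ne', mul_one, Real.rpow_two]
  rfl

lemma volFamily_ne_zero (hp : p.2 ∈ φ.1.target) : volFamily Ω φ p ≠ 0 := (Ω.pos φ _ hp).ne'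

lemma det_metricFamily_ne_zero [NeZero n] (hp : p ∈ familyDomain c₀ v φ) :
    (metricFamily c₀ v Ω φ p).det ≠ 0 := by
  rw [det_metricFamily hp]
  exact pow_ne_zero 2 (volFamily_ne_zero hp.1)

lemma dirDeriv_comp_snd (f : Coord n → ℝ) (p : ℝ × Coord n) (hf : DifferentiableAt ℝ f p.2) :
    dirDeriv (1, 0) (fun q : ℝ × Coord n => f q.2) p = 0 := by
  have h : HasFDerivAt (fun q : ℝ × Coord n => f q.2)
      ((fderiv ℝ f p.2).comp (ContinuousLinearMap.snd ℝ ℝ (Coord n))) p :=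
    hf.hasFDerivAt.comp p hasFDerivAt_snd
  simp [dirDeriv, h.fderiv]

lemma dirDeriv_volFamily (hp : p.2 ∈ φ.1.target) : dirDeriv (1, 0) (volFamily Ω φ) p = 0 :=
  dirDeriv_comp_snd _ _ (((Ω.smooth φ).contDiffAt (φ.1.open_target.mem_nhds hp)).diff)

lemma dirDeriv_lineFamily (hp : p.2 ∈ φ.1.target) (i j : Fin n) :
    dirDeriv (1, 0) (fun q => lineFamily c₀ v φ q i j) p = v.coeff φ p.2 i j := by
  have hU := φ.1.open_target.mem_nhds hp
  have h1 := ((c₀.smooth φ i j).contDiffAt hU).diff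
  have h2 := ((v.smooth φ i j).contDiffAt hU).diff
  have e : (fun q => lineFamily c₀ v φ q i j) =
      fun q : ℝ × Coord n => c₀.coeff φ q.2 i j + q.1 * v.coeff φ q.2 i j := rfl
  have h1' : DifferentiableAt ℝ (fun q : ℝ × Coord n => c₀.coeff φ q.2 i j) p :=
    DifferentiableAt.comp p h1 differentiableAt_snd
  have h2' : DifferentiableAt ℝ (fun q : ℝ × Coord n => v.coeff φ q.2 i j) p :=
    DifferentiableAt.comp p h2 differentiableAt_snd
  have h3 : dirDeriv (1, 0) (fun q : ℝ × Coord n => q.1) p = 1 := by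
    simp [dirDeriv, fderiv_fst]
  rw [e, dirDeriv_add _ h1' (DifferentiableAt.fun_mul differentiableAt_fst h2'),
    dirDeriv_comp_snd _ _ h1, dirDeriv_mul _ differentiableAt_fst h2', dirDeriv_comp_snd _ _ h2, h3]
  ring

/-- The derivative of `g_t` in `t`: by Jacobi's formula the normalization of the determinant removes
the trace of `v`. -/
lemma dirDeriv_metricFamily [NeZero n] (hp : p ∈ familyDomain c₀ v φ) :
    (Matrix.of fun i j => dirDeriv (1, 0) (fun q => metricFamily c₀ v Ω φ q i j) p) =
      (Ω.coeff φ p.2 ^ (2 / (n : ℝ)) * (lineFamily c₀ v φ p).det ^ (-1 / (n : ℝ))) •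
          v.coeff φ p.2 +
        (-(1 / (n : ℝ)) * ∑ i, ∑ j, (lineFamily c₀ v φ p)⁻¹ i j * v.coeff φ p.2 j i) •
          metricFamily c₀ v Ω φ p := by
  have hL := contDiffAt_lineFamily (c₀ := c₀) (v := v) hp.1
  have hdet := contDiffAt_det hL
  have h1 : ContDiffAt ℝ ∞ (fun q => volFamily Ω φ q ^ (2 / (n : ℝ))) p :=
    (contDiffAt_volFamily hp.1).rpow_const_of_ne (Ω.pos φ _ hp.1).ne'
  have h2 : ContDiffAt ℝ ∞ (fun q => (lineFamily c₀ v φ q).det ^ (-1 / (n : ℝ))) p :=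
    hdet.rpow_const_of_ne hp.2.ne'
  have d1 : dirDeriv (1, 0) (fun q => volFamily Ω φ q ^ (2 / (n : ℝ))) p = 0 :=
    dirDeriv_comp_snd (fun y => Ω.coeff φ y ^ (2 / (n : ℝ))) p
      (((Ω.smooth φ).contDiffAt (φ.1.open_target.mem_nhds hp.1)).rpow_const_of_ne
        (Ω.pos φ _ hp.1).ne').diff
  have d2 : dirDeriv (1, 0) (fun q => (lineFamily c₀ v φ q).det ^ (-1 / (n : ℝ))) p =
      -(1 / (n : ℝ)) * (lineFamily c₀ v φ p).det ^ (-1 / (n : ℝ)) *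
        ∑ i, ∑ j, (lineFamily c₀ v φ p)⁻¹ i j * v.coeff φ p.2 j i := by
    have e := (hdet.diff.hasFDerivAt.rpow_const (p := -1 / (n : ℝ)) (Or.inl hp.2.ne')).fderiv
    have e' := dirDeriv_det (1, 0) hL hp.2.ne'
    simp only [dirDeriv_lineFamily hp.1] at e'
    simp only [dirDeriv] at e' ⊢
    rw [e, smul_apply, e', Real.rpow_sub_one hp.2.ne', smul_eq_mul]
    have := hp.2.ne'
    field_simp
  ext i j
  have e : (fun q => metricFamily c₀ v Ω φ q i j) = fun q => volFamily Ω φ q ^ (2 / (n : ℝ)) *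
      ((lineFamily c₀ v φ q).det ^ (-1 / (n : ℝ)) * lineFamily c₀ v φ q i j) := rfl
  rw [Matrix.of_apply, e, dirDeriv_mul _ h1.diff (ContDiffAt.diff (h2.mul (hL i j))),
    dirDeriv_mul _ h2.diff (hL i j).diff, d1, d2, dirDeriv_lineFamily hp.1]
  simp only [metricFamily, volFamily, Matrix.add_apply, Matrix.smul_apply, smul_eq_mul]
  ring

end Family

/-! ### Integration over the path -/

open MeasureTheory

section Integral

variable {n : ℕ} {M : Type*} [TopologicalSpace M] [T2Space M] [CompactSpace M]
  [ChartedSpace (Coord n) M] [IsManifold (𝓡 n) ∞ M]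

lemma integralDensity_congr {f g : Chart n M → Coord n → ℝ}
    (h : ∀ φ, ∀ y ∈ φ.1.target, f φ y = g φ y) : integralDensity f = integralDensity g := by
  rw [integralDensity_eq_sum, integralDensity_eq_sum]
  refine Finset.sum_congr rfl fun x _ =>
    setIntegral_congr_fun (centered n x).1.open_target.measurableSet fun y hy => ?_
  simp only [h _ y hy]

lemma localBump_eq_zero {x : M} {y : Coord n} (hy : y ∈ (centered n x).1.target)
    (h : y ∉ bumpSupport n x) : localBump (centered n x) x y = 0 :=
  (localBump_eventuallyEq_zero _ x hy (symm_notMem_tsupport hy h)).self_of_nhds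

lemma continuousOn_localBump (φ : Chart n M) (x : M) : ContinuousOn (localBump φ x) φ.1.target :=
  fun _ hy => (contDiffAt_localBump φ x hy).continuousAt.continuousWithinAt

lemma integrableOn_localBump_mul (x : M) {f : Coord n → ℝ}
    (hf : ContinuousOn f (centered n x).1.target) :
    IntegrableOn (fun y => localBump (centered n x) x y * f y) (centered n x).1.target :=
  integrableOn_of_compact (centered n x).1.open_target (isCompact_bumpSupport x)
    (bumpSupport_subset x) ((continuousOn_localBump _ x).mul hf) fun y hy h => by
      rw [localBump_eq_zero hy h, zero_mul]

lemma integralDensity_add {f g : Chart n M → Coord n → ℝ}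
    (hf : ∀ φ : Chart n M, ContinuousOn (f φ) φ.1.target)
    (hg : ∀ φ : Chart n M, ContinuousOn (g φ) φ.1.target) :
    integralDensity (fun φ y => f φ y + g φ y) = integralDensity f + integralDensity g := by
  simp only [integralDensity_eq_sum, mul_add, ← Finset.sum_add_distrib]
  exact Finset.sum_congr rfl fun x _ => integral_add (integrableOn_localBump_mul x (hf _))
    (integrableOn_localBump_mul x (hg _))

lemma integralDensity_of_isEmpty [IsEmpty M] (f : Chart n M → Coord n → ℝ) :
    integralDensity f = 0 :=
  finsum_of_isEmpty _

/-- A density that is continuous and positive in every chart has positive integral. -/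
lemma integralDensity_pos [Nonempty M] {f : Chart n M → Coord n → ℝ}
    (hf : ∀ φ : Chart n M, ContinuousOn (f φ) φ.1.target)
    (hpos : ∀ φ, ∀ y ∈ φ.1.target, 0 < f φ y) : 0 < integralDensity f := by
  rw [integralDensity_eq_sum]
  have hnn : ∀ x, ∀ y ∈ (centered n x).1.target,
      0 ≤ localBump (centered n x) x y * f (centered n x) y := fun x y hy =>
    mul_nonneg ((partition n M).nonneg x _) (hpos _ y hy).le
  refine Finset.sum_pos' (fun x _ =>
    setIntegral_nonneg (centered n x).1.open_target.measurableSet (hnn x)) ?_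
  obtain ⟨z⟩ := ‹Nonempty M›
  obtain ⟨x, hx⟩ := (partition n M).exists_pos_of_mem (Set.mem_univ z)
  have hxS : x ∈ bumpIndices n M := by
    by_contra h
    exact hx.ne' (partition_eq_zero h z)
  refine ⟨x, hxS, ?_⟩
  set φ := centered n x with hφ
  have hz : z ∈ φ.1.source := tsupport_partition_subset x (subset_tsupport _ hx.ne')
  have hy : φ.1 z ∈ φ.1.target := φ.1.map_source hz
  rw [setIntegral_pos_iff_support_of_nonneg_ae
    ((ae_restrict_iff' φ.1.open_target.measurableSet).2 (Filter.Eventually.of_forall (hnn x)))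
    (integrableOn_localBump_mul x (hf _))]
  have hopen : IsOpen (φ.1.target ∩ localBump φ x ⁻¹' {r | 0 < r}) :=
    (continuousOn_localBump φ x).isOpen_inter_preimage φ.1.open_target isOpen_Ioi
  have hne : (φ.1.target ∩ localBump φ x ⁻¹' {r | 0 < r}).Nonempty :=
    ⟨φ.1 z, hy, by simpa [localBump, φ.1.left_inv hz] using hx⟩
  refine (hopen.measure_pos volume hne).trans_le (measure_mono fun y hy => ⟨?_, hy.1⟩)
  exact (mul_pos hy.2 (hpos _ y hy.1)).ne'

/-- The fundamental theorem of calculus for the integral of a family of densities, by Fubini's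
theorem in each chart. -/
lemma integral_integralDensity_dirDeriv {F : Chart n M → ℝ × Coord n → ℝ}
    (hF : ∀ φ, ∀ t ∈ Set.Icc (0 : ℝ) 1, ∀ y ∈ φ.1.target, ContDiffAt ℝ ∞ (F φ) (t, y)) :
    IntegrableOn (fun t => integralDensity fun φ y => dirDeriv (1, 0) (F φ) (t, y))
        (Set.Icc (0 : ℝ) 1) ∧
      ∫ t in Set.Icc (0 : ℝ) 1, integralDensity (fun φ y => dirDeriv (1, 0) (F φ) (t, y)) =
        integralDensity (fun φ y => F φ (1, y)) - integralDensity (fun φ y => F φ (0, y)) := by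
  set I := Set.Icc (0 : ℝ) 1 with hI
  have hint : ∀ x, Integrable (fun p : ℝ × Coord n => localBump (centered n x) x p.2 *
      dirDeriv (1, 0) (F (centered n x)) (p.1, p.2))
      ((volume.restrict I).prod (volume.restrict (centered n x).1.target)) := by
    intro x
    rw [Measure.prod_restrict]
    refine IntegrableOn.of_forall_sdiff_eq_zero (s := I ×ˢ bumpSupport n x) ?_
      (measurableSet_Icc.prod (centered n x).1.open_target.measurableSet) ?_
    · refine ContinuousOn.integrableOn_compact (isCompact_Icc.prod (isCompact_bumpSupport x)) ?_
      intro p hp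
      have hy := bumpSupport_subset x hp.2
      refine (ContinuousAt.mul ?_ ?_).continuousWithinAt
      · exact (contDiffAt_localBump _ x hy).continuousAt.comp continuousAt_snd
      · exact (contDiffAt_dirDeriv _ (hF _ p.1 hp.1 p.2 hy)).continuousAt
    · rintro p ⟨hp, hp'⟩
      rw [localBump_eq_zero hp.2 fun h => hp' ⟨hp.1, h⟩, zero_mul]
  have hFc : ∀ t ∈ I, ∀ φ : Chart n M, ContinuousOn (fun y => F φ (t, y)) φ.1.target :=
    fun t ht φ y hy => (ContinuousAt.comp (g := F φ) (hF φ t ht y hy).continuousAt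
      (by fun_prop : ContinuousAt (fun y : Coord n => (t, y)) y)).continuousWithinAt
  have hftc : ∀ φ : Chart n M, ∀ y ∈ φ.1.target,
      ∫ t in I, dirDeriv (1, 0) (F φ) (t, y) = F φ (1, y) - F φ (0, y) := by
    intro φ y hy
    rw [hI, integral_Icc_eq_integral_Ioc, ← intervalIntegral.integral_of_le zero_le_one]
    refine intervalIntegral.integral_eq_sub_of_hasDerivAt (f := fun t => F φ (t, y))
      (fun t ht => ?_) (ContinuousOn.intervalIntegrable fun t ht => ?_)
    · rw [Set.uIcc_of_le zero_le_one] at ht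
      exact deriv_slice (hF φ t ht y hy).diff
    · rw [Set.uIcc_of_le zero_le_one] at ht
      exact (ContinuousAt.comp (g := dirDeriv (1, 0) (F φ))
        (f := fun t : ℝ => (t, y))
        (contDiffAt_dirDeriv _ (hF φ t ht y hy)).continuousAt
        (by fun_prop : ContinuousAt (fun t : ℝ => (t, y)) t)).continuousWithinAt
  constructor
  · simp only [integralDensity_eq_sum]
    exact integrable_finsetSum _ fun x _ => (hint x).integral_prod_left
  · simp only [integralDensity_eq_sum]
    rw [integral_finsetSum _ fun x _ => (hint x).integral_prod_left, ← Finset.sum_sub_distrib]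
    refine Finset.sum_congr rfl fun x _ => ?_
    rw [integral_integral_swap (hint x), ← integral_sub
      (integrableOn_localBump_mul x (hFc 1 (by simp [hI]) _))
      (integrableOn_localBump_mul x (hFc 0 (by simp [hI]) _))]
    refine setIntegral_congr_fun (centered n x).1.open_target.measurableSet fun y hy => ?_
    simp only
    rw [integral_const_mul, hftc _ y hy, mul_sub]

end Integral

section Path

variable {n : ℕ} {M : Type*} [TopologicalSpace M] [ChartedSpace (Coord n) M]
  {c₀ : ConformalClass n M} {v : WeightedTensor n M (-2 / (n : ℝ))} {Ω : PosDensity n M}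

/-- For `t ∈ [0, 1]` the form `c₀ + t v` stays positive definite. -/
lemma mem_familyDomain (hv : ∀ t : unitInterval, ∀ φ, ∀ y ∈ φ.1.target,
      (c₀.coeff φ y + (t : ℝ) • v.coeff φ y).det ≠ 0) (φ : Chart n M) {t : ℝ}
    (ht : t ∈ Set.Icc (0 : ℝ) 1) {y : Coord n} (hy : y ∈ φ.1.target) :
    (t, y) ∈ familyDomain c₀ v φ :=
  ⟨hy, (posDef_add_smul (c₀.posDef φ y hy) (v.symmetric φ y hy) (fun s => hv s φ y hy)
    ⟨t, ht⟩).det_pos⟩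

variable [NeZero n]

/-- The transformation law of the metrics `g_t` under a change of charts. -/
lemma metricFamily_transform (hv : ∀ t : unitInterval, ∀ φ, ∀ y ∈ φ.1.target,
      (c₀.coeff φ y + (t : ℝ) • v.coeff φ y).det ≠ 0) (φ ψ : Chart n M) {t : ℝ}
    (ht : t ∈ Set.Icc (0 : ℝ) 1) {y : Coord n} (hy : y ∈ φ.1.target)
    (hy' : φ.1.symm y ∈ ψ.1.source) :
    metricFamily c₀ v Ω φ (t, y) = (jacobian φ ψ y).transpose *
      metricFamily c₀ v Ω ψ (t, ψ.1 (φ.1.symm y)) * jacobian φ ψ y := by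
  have h := (Ω.metric (c₀.path v hv ⟨t, ht⟩)).transform φ ψ (φ.1.symm y)
    ⟨φ.1.map_target hy, hy'⟩
  rw [φ.1.right_inv hy, Real.rpow_zero, one_smul] at h
  exact h

/-- The variation field of the family `g_t` is a vector density. The time is interior to `[0, 1]`,
so that the transformation law of `g_t` may be differentiated in `t`. -/
lemma variationField_metricFamily_transform [IsManifold (𝓡 n) ∞ M]
    (hv : ∀ t : unitInterval, ∀ φ, ∀ y ∈ φ.1.target,
      (c₀.coeff φ y + (t : ℝ) • v.coeff φ y).det ≠ 0) {t : ℝ}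
    (ht : t ∈ Set.Ioo (0 : ℝ) 1) (φ ψ : Chart n M) {z : M} (hz : z ∈ φ.1.source ∩ ψ.1.source)
    (d : Fin n) :
    ∑ k, jacobian φ ψ (φ.1 z) d k *
        variationField spatial (metricFamily c₀ v Ω φ) (volFamily Ω φ) (1, 0) k (t, φ.1 z) =
      |(jacobian φ ψ (φ.1 z)).det| *
        variationField spatial (metricFamily c₀ v Ω ψ) (volFamily Ω ψ) (1, 0) d (t, ψ.1 z) := by
  have hy : φ.1 z ∈ φ.1.target := φ.1.map_source hz.1
  have hl : φ.1.symm (φ.1 z) = z := φ.1.left_inv hz.1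
  have hy' : φ.1.symm (φ.1 z) ∈ ψ.1.source := by rw [hl]; exact hz.2
  have hw : ψ.1 z ∈ ψ.1.target := ψ.1.map_source hz.2
  have hI : ∀ᶠ s in nhds t, s ∈ Set.Icc (0 : ℝ) 1 := Icc_mem_nhds ht.1 ht.2
  have h := variationField_transform (G := metricFamily c₀ v Ω φ) (G' := metricFamily c₀ v Ω ψ)
    (m := volFamily Ω φ) (m' := volFamily Ω ψ) (T := fun w => ψ.1 (φ.1.symm w)) (t := t)
    (contDiffAt_transition φ ψ hy hy')
    (hI.mono fun s hs => contDiffAt_metricFamily (mem_familyDomain hv φ hs hy))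
    (hI.mono fun s hs => by
      rw [hl]; exact contDiffAt_metricFamily (mem_familyDomain hv ψ hs hw))
    (hI.mono fun s hs => by
      rw [hl]
      exact Filter.mem_of_superset (ψ.1.open_target.mem_nhds hw) fun w hw' =>
        isSymm_metricFamily (p := (s, w)) hw')
    (hI.mono fun s hs => det_metricFamily_ne_zero (mem_familyDomain hv φ hs hy))
    (hI.mono fun s hs => by
      filter_upwards [φ.1.open_target.mem_nhds hy,
        (φ.1.continuousAt_symm hy).eventually (ψ.1.open_source.mem_nhds hy')] with w hw1 hw2
      exact metricFamily_transform hv φ ψ hs hw1 hw2)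
    (by rw [hl]; exact Ω.transform φ ψ z hz) d
  rw [hl] at h
  exact h

variable (c₀ v Ω) in
/-- The scalar curvature density `R(g_t) Ω` in the chart `φ`, as a function on `ℝ × ℝⁿ`. -/
def scalarDensity (φ : Chart n M) (p : ℝ × Coord n) : ℝ :=
  scalarAlong spatial (metricFamily c₀ v Ω φ) p * volFamily Ω φ p

lemma contDiffAt_scalarDensity {φ : Chart n M} {p : ℝ × Coord n}
    (hp : p ∈ familyDomain c₀ v φ) : ContDiffAt ℝ ∞ (scalarDensity c₀ v Ω φ) p :=
  (contDiffAt_scalarAlong (contDiffAt_metricFamily hp) (det_metricFamily_ne_zero hp)).mul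
    (contDiffAt_volFamily hp.1)

lemma vol_metric_path (hv : ∀ t : unitInterval, ∀ φ, ∀ y ∈ φ.1.target,
      (c₀.coeff φ y + (t : ℝ) • v.coeff φ y).det ≠ 0) (t : unitInterval) (φ : Chart n M)
    {y : Coord n} (hy : y ∈ φ.1.target) :
    √((Ω.metric (c₀.path v hv t)).coeff φ y).det = Ω.coeff φ y := by
  have h := det_metricFamily (Ω := Ω) (mem_familyDomain hv φ t.2 hy)
  change √(metricFamily c₀ v Ω φ ((t : ℝ), y)).det = _
  rw [h]
  exact Real.sqrt_sq (Ω.pos φ y hy).le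

/-- The path starts at `c₀`, since `det c₀ = 1`; so `Ω^(2/n) c₀` is the metric at `t = 0`. -/
lemma metric_path_zero_mem (hv : ∀ t : unitInterval, ∀ φ, ∀ y ∈ φ.1.target,
      (c₀.coeff φ y + (t : ℝ) • v.coeff φ y).det ≠ 0) :
    Ω.metric (c₀.path v hv 0) ∈ c₀.metrics := by
  refine ⟨Ω, fun φ y hy => ?_⟩
  change Ω.coeff φ y ^ (2 / (n : ℝ)) • ((c₀.coeff φ y + (0 : ℝ) • v.coeff φ y).det ^
    (-1 / (n : ℝ)) • (c₀.coeff φ y + (0 : ℝ) • v.coeff φ y)) =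
    Ω.coeff φ y ^ (2 / (n : ℝ)) • c₀.coeff φ y
  rw [zero_smul, add_zero, c₀.det_eq_one φ y hy, Real.one_rpow, one_smul]

end Path

section FirstVariation

variable {n : ℕ} [NeZero n] {M : Type*} [TopologicalSpace M] [T2Space M] [CompactSpace M]
  [ChartedSpace (Coord n) M] [IsManifold (𝓡 n) ∞ M]
  {c₀ : ConformalClass n M} {v : WeightedTensor n M (-2 / (n : ℝ))} {Ω : PosDensity n M}

/-- For `0 < t < 1`, the integral of the variation of the scalar curvature density is
`pathIntegrand`: the divergence term integrates to zero. -/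
lemma integralDensity_dirDeriv_scalarDensity (hv : ∀ t : unitInterval, ∀ φ, ∀ y ∈ φ.1.target,
      (c₀.coeff φ y + (t : ℝ) • v.coeff φ y).det ≠ 0) (t : unitInterval)
    (ht : (t : ℝ) ∈ Set.Ioo (0 : ℝ) 1) :
    integralDensity (fun φ y => dirDeriv (1, 0) (scalarDensity c₀ v Ω φ) ((t : ℝ), y)) =
      c₀.pathIntegrand v hv Ω t := by
  set X : Chart n M → Fin n → Coord n → ℝ := fun φ k y =>
    variationField spatial (metricFamily c₀ v Ω φ) (volFamily Ω φ) (1, 0) k ((t : ℝ), y) with hX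
  have hdom := fun (φ : Chart n M) y (hy : y ∈ φ.1.target) => mem_familyDomain hv φ t.2 hy
  have hslice : ∀ (φ : Chart n M) (f : ℝ × Coord n → ℝ),
      (∀ y ∈ φ.1.target, ContDiffAt ℝ ∞ f ((t : ℝ), y)) →
      ∀ y ∈ φ.1.target, ContDiffAt ℝ ∞ (fun z => f ((t : ℝ), z)) y := fun φ f hf y hy =>
    ContDiffAt.comp (g := f) y (hf y hy) (by fun_prop)
  have hXs' : ∀ φ k, ∀ y ∈ φ.1.target, ContDiffAt ℝ ∞
      (variationField spatial (metricFamily c₀ v Ω φ) (volFamily Ω φ) (1, 0) k) ((t : ℝ), y) :=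
    fun φ k y hy => contDiffAt_variationField (contDiffAt_metricFamily (hdom φ y hy))
      (det_metricFamily_ne_zero (hdom φ y hy)) (contDiffAt_volFamily hy) _ k
  have hXs : ∀ φ k, ∀ y ∈ φ.1.target, ContDiffAt ℝ ∞ (X φ k) y := fun φ k =>
    hslice φ _ (hXs' φ k)
  have hdiv := integralDensity_divergence hXs fun φ ψ z hz d =>
    variationField_metricFamily_transform hv ht φ ψ hz d
  set D : Chart n M → Coord n → ℝ := fun φ y => ∑ k, pderiv k (X φ k) y with hD
  set E : Chart n M → Coord n → ℝ := fun φ y =>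
    dirDeriv (1, 0) (scalarDensity c₀ v Ω φ) ((t : ℝ), y) with hE
  have hDc : ∀ φ : Chart n M, ContinuousOn (D φ) φ.1.target := fun φ =>
    continuousOn_finsetSum _ fun k _ => continuousOn_pderiv (hXs φ k) k
  have hEc : ∀ φ : Chart n M, ContinuousOn (E φ) φ.1.target := fun φ y hy =>
    (hslice φ _ (fun y hy => contDiffAt_dirDeriv _ (contDiffAt_scalarDensity (hdom φ y hy)))
      y hy).continuousAt.continuousWithinAt
  have hED : integralDensity (fun φ y => E φ y - D φ y) = integralDensity E := by
    have h := integralDensity_add (f := fun φ y => E φ y - D φ y) (g := D)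
      (fun φ => (hEc φ).sub (hDc φ)) hDc
    simp only [sub_add_cancel] at h
    rw [hdiv, add_zero] at h
    exact h.symm
  rw [← hED]
  refine integralDensity_congr fun φ y hy => ?_
  have hp := hdom φ y hy
  have hvar := dirDeriv_scalarAlong (e := spatial) (G := metricFamily c₀ v Ω φ)
    (m := volFamily Ω φ) (τ := (1, 0)) (isOpen_familyDomain φ)
    (fun q hq => contDiffAt_metricFamily hq) (fun q hq => isSymm_metricFamily hq.1)
    (fun q hq => det_metricFamily_ne_zero hq) (fun q hq => contDiffAt_volFamily hq.1)
    (fun q hq => det_metricFamily hq) (fun q hq => dirDeriv_volFamily hq.1) hp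
  have hdiv' : D φ y = ∑ k, dirDeriv (spatial k)
      (variationField spatial (metricFamily c₀ v Ω φ) (volFamily Ω φ) (1, 0) k) ((t : ℝ), y) :=
    Finset.sum_congr rfl fun k _ => pderiv_slice k (hXs' φ k y hy).diff
  have hE' : E φ y - D φ y = -(pairing (metricFamily c₀ v Ω φ ((t : ℝ), y))
      (Matrix.of fun i j => dirDeriv (1, 0) (fun q => metricFamily c₀ v Ω φ q i j) ((t : ℝ), y))
      (ricciAlong spatial (metricFamily c₀ v Ω φ) ((t : ℝ), y)) * volFamily Ω φ ((t : ℝ), y)) := by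
    rw [hdiv', sub_eq_iff_eq_add]
    exact hvar
  have hΩ := Ω.pos φ y hy
  have hn : (n : ℝ) ≠ 0 := NeZero.ne _
  have hpow : Ω.coeff φ y ^ (2 / (n : ℝ)) * Ω.coeff φ y ^ (1 - 2 / (n : ℝ)) = Ω.coeff φ y := by
    rw [← Real.rpow_add hΩ, add_sub_cancel, Real.rpow_one]
  have hric : ricci (fun z => metricFamily c₀ v Ω φ ((t : ℝ), z)) y =
      ricciAlong spatial (metricFamily c₀ v Ω φ) ((t : ℝ), y) :=
    ricci_slice (isOpen_familyDomain φ) (fun q hq => contDiffAt_metricFamily hq)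
      (fun q hq => det_metricFamily_ne_zero hq) hp
  rw [hE', dirDeriv_metricFamily hp]
  refine (pairing_variation (isSymm_lineFamily hy) (v.symmetric φ y hy) hp.2.ne'
    (Real.rpow_pos_of_pos hΩ _).ne' (Real.rpow_pos_of_pos hp.2 _).ne' hpow).trans ?_
  rw [← hric]
  rfl

/-- Along the path the volume is constant, so that only the total scalar curvature varies. -/
lemma totalScalar_metric_path (hv : ∀ t : unitInterval, ∀ φ, ∀ y ∈ φ.1.target,
      (c₀.coeff φ y + (t : ℝ) • v.coeff φ y).det ≠ 0) (t : unitInterval) :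
    (Ω.metric (c₀.path v hv t)).totalScalar =
      integralDensity (fun φ y => scalarDensity c₀ v Ω φ ((t : ℝ), y)) /
        Ω.vol ^ (1 - 2 / (n : ℝ)) := by
  have h1 : (Ω.metric (c₀.path v hv t)).vol = Ω.vol :=
    integralDensity_congr fun φ y hy => vol_metric_path hv t φ hy
  rw [Metric.totalScalar, h1]
  congr 1
  refine integralDensity_congr fun φ y hy => ?_
  have hs : scalarCurv (fun z => metricFamily c₀ v Ω φ ((t : ℝ), z)) y =
      scalarAlong spatial (metricFamily c₀ v Ω φ) ((t : ℝ), y) :=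
    scalarCurv_slice (isOpen_familyDomain φ) (fun q hq => contDiffAt_metricFamily hq)
      (fun q hq => det_metricFamily_ne_zero hq) (mem_familyDomain hv φ t.2 hy)
  rw [vol_metric_path hv t φ hy, scalarDensity, ← hs]
  rfl

/-- The first variation formula, integrated over the path. -/
lemma integral_pathIntegrand (hv : ∀ t : unitInterval, ∀ φ, ∀ y ∈ φ.1.target,
      (c₀.coeff φ y + (t : ℝ) • v.coeff φ y).det ≠ 0) :
    Integrable (c₀.pathIntegrand v hv Ω) ∧
      ∫ t, c₀.pathIntegrand v hv Ω t =
        integralDensity (fun φ y => scalarDensity c₀ v Ω φ (1, y)) -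
          integralDensity (fun φ y => scalarDensity c₀ v Ω φ (0, y)) := by
  obtain ⟨h1, h2⟩ := integral_integralDensity_dirDeriv (F := scalarDensity c₀ v Ω)
    fun φ t ht y hy => contDiffAt_scalarDensity (mem_familyDomain hv φ ht hy)
  set H : ℝ → ℝ := fun t => integralDensity fun φ y =>
    dirDeriv (1, 0) (scalarDensity c₀ v Ω φ) (t, y) with hH
  have hae : (fun t : unitInterval => H t) =ᵐ[volume] c₀.pathIntegrand v hv Ω := by
    -- the endpoints, where the transformation laws cannot be differentiated in `t`, are null
    have hnull : ∀ᵐ t : unitInterval, t ≠ 0 ∧ t ≠ 1 :=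
      (Measure.ae_ne volume 0).and (Measure.ae_ne volume 1)
    filter_upwards [hnull] with t ht
    exact integralDensity_dirDeriv_scalarDensity hv t
      ⟨unitInterval.pos_iff_ne_zero.2 ht.1, unitInterval.lt_one_iff_ne_one.2 ht.2⟩
  have hmp := unitInterval.measurePreserving_coe
  have hme := unitInterval.measurableEmbedding_coe
  constructor
  · exact ((hmp.integrable_comp_emb hme).2 h1).congr hae
  · rw [← integral_congr_ae hae, hmp.integral_comp hme H]
    exact h2

end FirstVariation

end Yamabe
end

open Yamabe in
theorem proposition2p6 {n : ℕ} [NeZero n] {M : Type*} [TopologicalSpace M] [T2Space M]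
    [CompactSpace M] [ChartedSpace (EuclideanSpace ℝ (Fin n)) M] [IsManifold (𝓡 n) ∞ M]
    (c₀ : ConformalClass n M) (v : WeightedTensor n M (-2 / (n : ℝ)))
    (hv : ∀ t : unitInterval, ∀ φ, ∀ y ∈ φ.1.target,
      (c₀.coeff φ y + (t : ℝ) • v.coeff φ y).det ≠ 0)
    (Ω : PosDensity n M)
    (hΩ : IsYamabeMetric (c₀.path v hv 1) (Ω.metric (c₀.path v hv 1))) :
    MeasureTheory.Integrable (c₀.pathIntegrand v hv Ω) ∧
      ((Ω.vol ^ (1 - 2 / (n : ℝ)) : ℝ) : EReal) *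
          ((c₀.path v hv 1).yamabeConstant - c₀.yamabeConstant) ≥
        ((∫ t, c₀.pathIntegrand v hv Ω t : ℝ) : EReal) := by
  obtain ⟨hint, heq⟩ := integral_pathIntegrand (Ω := Ω) hv
  refine ⟨hint, ?_⟩
  set g₀ := Ω.metric (c₀.path v hv 0)
  set g₁ := Ω.metric (c₀.path v hv 1)
  set a : ℝ := Ω.vol ^ (1 - 2 / (n : ℝ)) with ha
  have hcont : ∀ φ : Chart n M, ContinuousOn (Ω.coeff φ) φ.1.target := fun φ =>
    (Ω.smooth φ).continuousOn
  have h1 : (g₁.totalScalar : EReal) ≤ (c₀.path v hv 1).yamabeConstant :=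
    le_iInf₂ fun g hg => EReal.coe_le_coe_iff.2 (hΩ.2 g hg)
  have h0 : c₀.yamabeConstant ≤ g₀.totalScalar := iInf₂_le _ (metric_path_zero_mem hv)
  have hvol : 0 ≤ Ω.vol := by
    rcases isEmpty_or_nonempty M with hM | hM
    · exact (integralDensity_of_isEmpty _).ge
    · exact (integralDensity_pos hcont Ω.pos).le
  have ha0 : 0 ≤ a := Real.rpow_nonneg hvol _
  -- on the empty manifold the volume vanishes, but so does the total scalar curvature
  have hmul : a * (g₁.totalScalar - g₀.totalScalar) = ∫ t, c₀.pathIntegrand v hv Ω t := by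
    rw [heq, totalScalar_metric_path, totalScalar_metric_path]
    rcases isEmpty_or_nonempty M with hM | hM
    · simp [integralDensity_of_isEmpty]
    · have : a ≠ 0 := (Real.rpow_pos_of_pos (integralDensity_pos hcont Ω.pos) _).ne'
      rw [← sub_div, mul_div_cancel₀ _ this]
      rfl
  rw [ge_iff_le, ← hmul, EReal.coe_mul, EReal.coe_sub]
  exact mul_le_mul_of_nonneg_left (EReal.sub_le_sub h1 h0) (EReal.coe_nonneg.2 ha0)
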